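/- Let $p>3$ be a prime and $k\ge 1$ an integer. Let $M_k(\Gamma_0(p),\mathbf Z)$ (resp. $S_k(\Gamma_0(p),\mathbf Z)$) be the group of holomorphic modular forms (resp. cusp forms, vanishing at both cusps) of weight $k$ for $\Gamma_0(p)$ whose $q$-expansion at $\infty$ has integer coefficients, and let $M_k(\Gamma_0(p),\overline{\mathbf F}_p)$ (resp. $S_k(\Gamma_0(p),\overline{\mathbf F}_p)$) be the $\overline{\mathbf F}_p$-subspace of $\overline{\mathbf F}_p[[q]]$ spanned by the reductions mod $p$ of these $q$-expansions. For $n\ge1$ the Hecke operator $T_n$ of weight $k$ sends $\sum a_mq^m$ to $\sum_m\Bigl(\sum_{d\mid\gcd(m,n),\,p\nmid d}d^{k-1}a_{mn/d^2}\Bigr)q^m$ (so $T_p=U_p$). A Hecke eigenform in $M_k(\Gamma_0(p),\overline{\mathbf F}_p)$ is a nonzero element that is an eigenvector of $T_n$ for all $n\geq 1$. Put $\theta=q\,\frac{d}{dq}$. Let $f\in M_k(\Gamma_0(p),\overline{\mathbf F}_p)$ be a Hecke eigenform. Then: 1. $\theta f\in M_{k+2}(\Gamma_0(p),\overline{\mathbf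 F}_p)$, and $\theta f$ has constant term $0$. 2. If $T_nf=c\,f$ (in weight $k$), then $T_n(\theta f)=n\,c\,\theta f$ (in weight $k+2$). If $f$ is not a constant power series, then $\theta f\ne0$, so $\theta f$ is a Hecke eigenform in $M_{k+2}(\Gamma_0(p),\overline{\mathbf F}_p)$. 3. If $f\in S_k(\Gamma_0(p),\overline{\mathbf F}_p)$, or $(p-1)\nmid k$, or $p\mid k$, then $\theta f\in S_{k+2}(\Gamma_0(p),\overline{\mathbf F}_p)$. -/

import Mathlib

noncomputable section

namespace ModPForms

open PowerSeries

/-- An algebraic closure of the field with `p` elements. -/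
abbrev Fpbar (p : ℕ) [Fact p.Prime] : Type := AlgebraicClosure (ZMod p)

/-- The congruence subgroup `Γ₀(p)`, as a subgroup of `GL₂(ℝ)`. -/
abbrev Gam0 (p : ℕ) : Subgroup (GL (Fin 2) ℝ) :=
  (CongruenceSubgroup.Gamma0 p).map (Matrix.SpecialLinearGroup.mapGL ℝ)

/-- The power series with integer coefficients that are `q`-expansions at `∞` (with
`q = exp (2 π i τ)`) of holomorphic modular forms of weight `k` for `Γ₀(p)`:
the lattice `M_k(Γ₀(p), ℤ)`. -/
def integralForms (p : ℕ) (k : ℤ) : Set (PowerSeries ℤ) :=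
  {P | ∃ F : ModularForm (Gam0 p) k,
    UpperHalfPlane.qExpansion 1 F = PowerSeries.map (Int.castRingHom ℂ) P}

/-- The same for cusp forms (vanishing at every cusp): the lattice `S_k(Γ₀(p), ℤ)`. -/
def integralCuspForms (p : ℕ) (k : ℤ) : Set (PowerSeries ℤ) :=
  {P | ∃ F : CuspForm (Gam0 p) k,
    UpperHalfPlane.qExpansion 1 F = PowerSeries.map (Int.castRingHom ℂ) P}

/-- `M_k(Γ₀(p), F̄_p)`: the `F̄_p`-span of the reductions modulo `p` of the elements of
`M_k(Γ₀(p), ℤ)`. It is the image of `M_k(Γ₀(p), ℤ) ⊗ F̄_p` in `F̄_p⟦q⟧`. -/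
def M (p : ℕ) [Fact p.Prime] (k : ℤ) : Submodule (Fpbar p) (PowerSeries (Fpbar p)) :=
  Submodule.span (Fpbar p)
    (PowerSeries.map (Int.castRingHom (Fpbar p)) '' integralForms p k)

/-- `S_k(Γ₀(p), F̄_p)`: the `F̄_p`-span of the reductions modulo `p` of the elements of
`S_k(Γ₀(p), ℤ)`. -/
def S (p : ℕ) [Fact p.Prime] (k : ℤ) : Submodule (Fpbar p) (PowerSeries (Fpbar p)) :=
  Submodule.span (Fpbar p)
    (PowerSeries.map (Int.castRingHom (Fpbar p)) '' integralCuspForms p k)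

/-- The Hecke operator `T_n` (`n ≥ 1`) in weight `k` and level `Γ₀(p)` on `q`-expansions over
`F̄_p`: the `m`-th coefficient of `T_n f` is the sum of `d ^ (k - 1) * a (m n / d²)` over the
common divisors `d` of `m` and `n` that are prime to `p`. In particular `T_p = U_p`. -/
def heckeT (p : ℕ) [Fact p.Prime] (k : ℤ) (n : ℕ) (f : PowerSeries (Fpbar p)) :
    PowerSeries (Fpbar p) :=
  PowerSeries.mk fun m =>
    ∑ d ∈ (Nat.gcd m n).divisors with ¬ p ∣ d,
      (d : Fpbar p) ^ (k - 1) * PowerSeries.coeff (m * n / d ^ 2) f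

/-- A mod `p` Hecke eigenform of weight `k` and level `Γ₀(p)`: a nonzero element of
`M_k(Γ₀(p), F̄_p)` that is an eigenvector of every `T_n`, including `T_p`. -/
structure IsHeckeEigenform (p : ℕ) [Fact p.Prime] (k : ℤ) (f : PowerSeries (Fpbar p)) :
    Prop where
  mem : f ∈ M p k
  ne_zero : f ≠ 0
  eigen : ∀ n : ℕ, 0 < n → ∃ c : Fpbar p, heckeT p k n f = c • f

/-- The operator `θ = q d/dq`. -/
def theta (p : ℕ) [Fact p.Prime] (f : PowerSeries (Fpbar p)) : PowerSeries (Fpbar p) :=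
  PowerSeries.X * PowerSeries.derivative (Fpbar p) f

end ModPForms

end

/-!
Write `F` for a modular form of weight `k` for `Γ₀(p)` with `q`-expansion `P ∈ ℤ⟦q⟧` at `∞`, and
`b` for its value at the cusp `0`, the limit of `F ∣[k] S` at `i∞`.

**The eigenvalues.** On power series over `𝔽̄_p` one has `T_n θ = n θ T_n` (`heckeT_theta`), and a
`U_p`-eigenvector killed by `θ` is constant (`eq_C_of_theta_eq_zero`). This is formal. The rest of
the theorem is about `θ F` modulo `p`, does not use that the form is an eigenform, and by linearity
may be checked on reductions of integral forms.

**`θ` raises the weight by two.** The Serre derivative, corrected by a multiple of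
`(E₂(z) - p E₂(p z)) F`, gives the form `G = 12 θ F - k p E₂(p z) F` of weight `k + 2`. It is
congruent to `12 θ F` modulo `p`, and its value at the cusp `0` is `-k b / p`
(`IsIntegralForm.theta`).

**`θ F` is congruent to a cusp form.** The constant term of `G` is divisible by `p`, and if `F` is a
cusp form then so is `G`. If `k` is odd then `F = 0`. In general, to make `G` vanish at `0`, one
subtracts `p` times an integral form whose value at `0` is a suitable multiple of `b`. This is
possible if the integral forms of weight `k + 2` have poles at `0` of sufficient `p`-adic order.

* An upper bound for the pole of `F` is `v_p(b) ≥ -(k + ⌊k / (p - 1)⌋)`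
  (`IsIntegralForm.exists_int_mul_value`). It comes from the residue theorem: for `g = F(z) E(p z)
  (Δ(z) / Δ(p z) ^ p) ^ a` of weight two, where `E` has level one, the differential `g(z) dz` has
  poles at the cusps only, with integral residue at `∞`, so that its residue at `0`, which is a
  power of `p` times `b`, is an integer. For `F` itself the resulting bound is not sharp, and it is
  applied to a power of `F`. The residue theorem is proved by tracing `g` to level one (`cosetSum`)
  and integrating `g(z) dz` on the upper half plane (`intervalIntegral_eq_zero_of_weight_two`).
* Forms with a pole of the required order are products of `E(p z)` with powers of
  `(E_{p-1}(p z) - E_{p-1}(z)) / p`, which is integral up to a unit because `E_{p-1}` is congruent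
  to a constant modulo `p` by the theorem of von Staudt and Clausen
  (`exists_isIntegralForm_pole`). Write `k = r + i (p - 1)` with `0 ≤ r < p - 1`. If `r ≠ 0`, one
  takes `E` of weight `r + 2` and the power `i`. If `r = 0` there is no `E` of weight two; with
  weight `p + 1` and the power `i - 1` the order of the pole is one less, which suffices if `p ∣ k`,
  because of the factor `k` in the value of `G` at `0`.

Finally, the constant term at `∞` is a multiple of `p` and is removed by a multiple of
`E(z) - p ^ w E(p z)`, where `w = k + 2` (`IsIntegralForm.exists_mem_integralCuspForms`).
-/

noncomputable section

namespace ModPForms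

open PowerSeries UpperHalfPlane ModularForm CongruenceSubgroup Filter Topology MatrixGroups
open scoped Manifold

local notation "𝕢" => Function.Periodic.qParam

/-! ### Formal properties of `θ` and of the Hecke operators -/

section Formal

variable {p : ℕ} [Fact p.Prime]

lemma coeff_theta (f : PowerSeries (Fpbar p)) (m : ℕ) :
    coeff m (theta p f) = (m : Fpbar p) * coeff m f := by
  cases m with
  | zero => simp [theta]
  | succ m =>
    rw [theta, coeff_succ_X_mul, PowerSeries.coeff_derivative]
    push_cast
    ring

lemma constantCoeff_theta (f : PowerSeries (Fpbar p)) :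
    constantCoeff (theta p f) = 0 := by
  simp [theta]

lemma natCast_ne_zero_of_not_dvd {d : ℕ} (hd : ¬ p ∣ d) : (d : Fpbar p) ≠ 0 := by
  rwa [Ne, CharP.cast_eq_zero_iff (Fpbar p) p d]

/-- `T_n θ = n θ T_n`, because `d² (m n / d²) = m n` for every common divisor `d` of `m`, `n`. -/
lemma heckeT_theta (k : ℤ) (n : ℕ) (f : PowerSeries (Fpbar p)) :
    heckeT p (k + 2) n (theta p f) = (n : Fpbar p) • theta p (heckeT p k n f) := by
  ext m
  simp only [heckeT, coeff_mk, coeff_theta, PowerSeries.coeff_smul, smul_eq_mul,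
    Finset.mul_sum]
  refine Finset.sum_congr rfl fun d hd ↦ ?_
  obtain ⟨hd, hpd⟩ := Finset.mem_filter.mp hd
  have hdg := Nat.dvd_of_mem_divisors hd
  have hdm : d ∣ m := hdg.trans (Nat.gcd_dvd_left m n)
  have hdn : d ∣ n := hdg.trans (Nat.gcd_dvd_right m n)
  have hdvd : d ^ 2 ∣ m * n := by rw [sq]; exact mul_dvd_mul hdm hdn
  have hd0 : (d : Fpbar p) ≠ 0 := natCast_ne_zero_of_not_dvd hpd
  have hmn : (d : Fpbar p) ^ 2 * ((m * n / d ^ 2 : ℕ) : Fpbar p) = m * n := by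
    exact_mod_cast congrArg (Nat.cast (R := Fpbar p)) (Nat.mul_div_cancel' hdvd)
  rw [show k + 2 - 1 = (k - 1) + 2 by ring, zpow_add₀ hd0, zpow_ofNat]
  linear_combination (d : Fpbar p) ^ (k - 1) * coeff (m * n / d ^ 2) f * hmn

lemma heckeT_theta_of_eigen {k : ℤ} {n : ℕ} {f : PowerSeries (Fpbar p)} {c : Fpbar p}
    (h : heckeT p k n f = c • f) :
    heckeT p (k + 2) n (theta p f) = ((n : Fpbar p) * c) • theta p f := by
  rw [heckeT_theta, h, mul_smul]
  congr 1
  ext m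
  simp only [coeff_theta, PowerSeries.coeff_smul, smul_eq_mul]
  ring

lemma coeff_heckeT_prime (k : ℤ) (f : PowerSeries (Fpbar p)) (m : ℕ) :
    coeff m (heckeT p k p f) = coeff (m * p) f := by
  have hp := (Fact.out : p.Prime)
  have : {d ∈ (Nat.gcd m p).divisors | ¬ p ∣ d} = {1} := by
    ext d
    simp only [Finset.mem_filter, Nat.mem_divisors, Finset.mem_singleton]
    constructor
    · rintro ⟨⟨hd, -⟩, hpd⟩
      rcases (Nat.dvd_prime hp).mp (hd.trans (Nat.gcd_dvd_right m p)) with h | h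
      · exact h
      · exact absurd h.symm.dvd hpd
    · rintro rfl
      exact ⟨⟨one_dvd _, (Nat.gcd_pos_of_pos_right m hp.pos).ne'⟩,
        hp.one_lt.not_ge ∘ Nat.le_of_dvd one_pos⟩
  simp [heckeT, this]

/-- A `U_p`-eigenvector killed by `θ` is constant: its coefficients vanish away from multiples
of `p`, and the relation `a (p m) = c a m` propagates this to all `m ≥ 1`. -/
lemma eq_C_of_theta_eq_zero {k : ℤ} {f : PowerSeries (Fpbar p)} {c : Fpbar p}
    (h : heckeT p k p f = c • f) (hθ : theta p f = 0) : f = C (constantCoeff f) := by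
  have hp := (Fact.out : p.Prime)
  have key : ∀ m : ℕ, 0 < m → coeff m f = 0 := by
    intro m
    induction m using Nat.strong_induction_on with
    | _ m ih =>
      intro hm
      by_cases hpm : p ∣ m
      · obtain ⟨r, rfl⟩ := hpm
        have hr : 0 < r := Nat.pos_of_mul_pos_left hm
        have h1 := congrArg (coeff r) h
        rw [coeff_heckeT_prime, PowerSeries.coeff_smul, ih r (by nlinarith [hp.one_lt]) hr,
          smul_zero] at h1
        rwa [mul_comm]
      · have h1 := coeff_theta f m
        rw [hθ, map_zero] at h1
        exact (mul_eq_zero.mp h1.symm).resolve_left (natCast_ne_zero_of_not_dvd hpm)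
  ext m
  rw [coeff_C]
  split_ifs with hm
  · subst hm; simp
  · exact key m (Nat.pos_of_ne_zero hm)

end Formal

/-! ### Functions invariant under `Γ₀(p)` and their behaviour at the two cusps -/

section Cusps

variable {p : ℕ} {k : ℤ}

lemma mem_Gamma0_iff_dvd {γ : SL(2, ℤ)} : γ ∈ Gamma0 p ↔ (p : ℤ) ∣ γ 1 0 := by
  rw [Gamma0_mem, ZMod.intCast_zmod_eq_zero_iff_dvd]

/-- The matrices `S T ^ n` represent the cosets `Γ₀(p) γ` with `γ ∉ Γ₀(p)`. -/
lemma slash_eq_slash_S_mul_T_zpow {F : ℍ → ℂ} (hF : ∀ γ ∈ Gamma0 p, F ∣[k] γ = F)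
    {γ : SL(2, ℤ)} {n : ℤ} (h : (p : ℤ) ∣ γ 1 1 - n * γ 1 0) :
    F ∣[k] γ = F ∣[k] (ModularGroup.S * ModularGroup.T ^ n) := by
  have hδ : γ * (ModularGroup.S * ModularGroup.T ^ n)⁻¹ ∈ Gamma0 p := by
    rw [mem_Gamma0_iff_dvd]
    have : (γ * (ModularGroup.S * ModularGroup.T ^ n)⁻¹) 1 0 = -(γ 1 1 - n * γ 1 0) := by
      rw [Matrix.SpecialLinearGroup.coe_mul, Matrix.SpecialLinearGroup.coe_inv,
        Matrix.SpecialLinearGroup.coe_mul, ModularGroup.coe_T_zpow, ModularGroup.S]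
      simp [Matrix.mul_apply, Fin.sum_univ_two, Matrix.adjugate_fin_two]
      ring
    rw [this]
    exact (dvd_neg).mpr h
  rw [← inv_mul_cancel_right γ (ModularGroup.S * ModularGroup.T ^ n), SlashAction.slash_mul,
    hF _ hδ]

lemma exists_slash_eq [Fact p.Prime] {F : ℍ → ℂ} (hF : ∀ γ ∈ Gamma0 p, F ∣[k] γ = F)
    (γ : SL(2, ℤ)) :
    F ∣[k] γ = F ∨ ∃ n : ℤ, F ∣[k] γ = F ∣[k] (ModularGroup.S * ModularGroup.T ^ n) := by
  by_cases hc : (p : ℤ) ∣ γ 1 0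
  · exact .inl (hF γ (mem_Gamma0_iff_dvd.mpr hc))
  · right
    have hcop : IsCoprime (γ 1 0) (p : ℤ) :=
      ((Nat.prime_iff_prime_int.mp Fact.out).coprime_iff_not_dvd.mpr hc).symm
    obtain ⟨u, v, huv⟩ := hcop
    refine ⟨u * γ 1 1, slash_eq_slash_S_mul_T_zpow hF ⟨v * γ 1 1, ?_⟩⟩
    linear_combination (-γ 1 1) * huv

lemma slash_T_zpow_apply (F : ℍ → ℂ) (n : ℤ) (z : ℍ) :
    (F ∣[k] (ModularGroup.T ^ n)) z = F ((n : ℝ) +ᵥ z) := by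
  rw [SL_slash_apply, ← UpperHalfPlane.modular_T_zpow_smul]
  have : denom (ModularGroup.T ^ n : SL(2, ℤ)) z = 1 := by
    rw [ModularGroup.denom_apply, ModularGroup.coe_T_zpow]
    simp
  erw [this]
  simp

lemma tendsto_vadd_atImInfty (x : ℝ) :
    Tendsto (fun z : ℍ ↦ x +ᵥ z) atImInfty atImInfty := by
  rw [atImInfty, tendsto_comap_iff]
  simpa [Function.comp_def] using tendsto_comap

lemma tendsto_slash_S_mul_T_zpow {F : ℍ → ℂ} {b : ℂ}
    (h : Tendsto (F ∣[k] ModularGroup.S) atImInfty (𝓝 b)) (n : ℤ) :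
    Tendsto (F ∣[k] (ModularGroup.S * ModularGroup.T ^ n)) atImInfty (𝓝 b) := by
  rw [SlashAction.slash_mul]
  refine (h.comp (tendsto_vadd_atImInfty (n : ℝ))).congr fun z ↦ ?_
  rw [slash_T_zpow_apply, Function.comp_apply]

lemma isBoundedAtImInfty_of_tendsto {F : ℍ → ℂ} {b : ℂ} (h : Tendsto F atImInfty (𝓝 b)) :
    IsBoundedAtImInfty F :=
  h.isBigO_one ℝ

variable (p) in
/-- A holomorphic function that is invariant under `Γ₀(p)`, bounded at `∞`, and has a limit at
the cusp `0`, as a modular form. -/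
def modularFormOfCusps [Fact p.Prime] (F : ℍ → ℂ) (b : ℂ)
    (hinv : ∀ γ ∈ Gamma0 p, F ∣[k] γ = F) (hol : MDiff F) (hinf : IsBoundedAtImInfty F)
    (hzero : Tendsto (F ∣[k] ModularGroup.S) atImInfty (𝓝 b)) : ModularForm (Gam0 p) k where
  toFun := F
  slash_action_eq' := by
    rintro _ ⟨γ, hγ, rfl⟩
    exact hinv γ hγ
  holo' := hol
  bdd_at_cusps' {c} hc := by
    rw [Subgroup.IsArithmetic.isCusp_iff_isCusp_SL2Z] at hc
    rw [OnePoint.isBoundedAt_iff_forall_SL2Z hc]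
    intro γ _
    rcases exists_slash_eq hinv γ with h | ⟨n, h⟩ <;> erw [h]
    · exact hinf
    · exact isBoundedAtImInfty_of_tendsto (tendsto_slash_S_mul_T_zpow hzero n)

variable (p) in
/-- A holomorphic function that is invariant under `Γ₀(p)` and vanishes at the cusps `∞` and `0`,
as a cusp form. -/
def cuspFormOfCusps [Fact p.Prime] (F : ℍ → ℂ)
    (hinv : ∀ γ ∈ Gamma0 p, F ∣[k] γ = F) (hol : MDiff F) (hinf : IsZeroAtImInfty F)
    (hzero : Tendsto (F ∣[k] ModularGroup.S) atImInfty (𝓝 0)) : CuspForm (Gam0 p) k where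
  toFun := F
  slash_action_eq' := by
    rintro _ ⟨γ, hγ, rfl⟩
    exact hinv γ hγ
  holo' := hol
  zero_at_cusps' {c} hc := by
    rw [Subgroup.IsArithmetic.isCusp_iff_isCusp_SL2Z] at hc
    rw [OnePoint.isZeroAt_iff_forall_SL2Z hc]
    intro γ _
    rcases exists_slash_eq hinv γ with h | ⟨n, h⟩ <;> erw [h]
    · exact hinf
    · exact tendsto_slash_S_mul_T_zpow hzero n

lemma slash_eq_of_mem_Gamma0 (F : ModularForm (Gam0 p) k) {γ : SL(2, ℤ)} (hγ : γ ∈ Gamma0 p) :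
    (F : ℍ → ℂ) ∣[k] γ = F :=
  SlashInvariantForm.slash_action_eqn F _ ⟨γ, hγ, rfl⟩

end Cusps

/-! ### Forms with integral expansion at `∞` and prescribed value at `0` -/

section IntegralForms

variable {p : ℕ} [Fact p.Prime] {k l : ℤ} {P Q : PowerSeries ℤ} {b c : ℂ}

omit [Fact p.Prime] in
lemma one_mem_strictPeriods : (1 : ℝ) ∈ (Gam0 p).strictPeriods := by simp

variable (p) in
/-- `P` is the `q`-expansion at `∞` of a modular form `F` of weight `k` for `Γ₀(p)`, and `b` is
the value at `i∞` of `F ∣[k] S`, that is, the value of `F` at the cusp `0`. -/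
def IsIntegralForm (k : ℤ) (P : PowerSeries ℤ) (b : ℂ) : Prop :=
  ∃ F : ModularForm (Gam0 p) k, qExpansion 1 F = PowerSeries.map (Int.castRingHom ℂ) P ∧
    Tendsto ((F : ℍ → ℂ) ∣[k] ModularGroup.S) atImInfty (𝓝 b)

/-- A bounded holomorphic periodic function on the upper half plane has a limit at `i∞`. -/
lemma tendsto_cuspFunction_zero {h : ℝ} (hh : 0 < h) {f : ℍ → ℂ}
    (hper : Function.Periodic (f ∘ ofComplex) h) (hol : MDiff f) (hb : IsBoundedAtImInfty f) :
    Tendsto f atImInfty (𝓝 (cuspFunction h f 0)) := by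
  have h1 := (analyticAt_cuspFunction_zero hh hper hol hb).continuousAt.tendsto.comp
    (qParam_tendsto_atImInfty hh)
  exact h1.congr fun z ↦ eq_cuspFunction z hh.ne' hper

lemma periodic_comp_ofComplex_of_vadd {f : ℍ → ℂ} {h : ℝ} (hf : ∀ z : ℍ, f (h +ᵥ z) = f z) :
    Function.Periodic (f ∘ ofComplex) h := by
  intro w
  by_cases! hw : 0 < w.im
  · have : 0 < (w + h).im := by simp [hw]
    simp only [Function.comp_apply, ofComplex_apply_of_im_pos this, ofComplex_apply_of_im_pos hw]
    rw [← hf ⟨w, hw⟩]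
    congr 1
    ext
    simp [add_comm]
  · have : (w + h).im ≤ 0 := by simpa using hw
    simp [ofComplex_apply_of_im_nonpos this, ofComplex_apply_of_im_nonpos hw]

lemma tendsto_atImInfty_coeff_zero (F : ModularForm (Gam0 p) k) :
    Tendsto F atImInfty (𝓝 ((qExpansion 1 F).coeff 0)) := by
  have hper := SlashInvariantFormClass.periodic_comp_ofComplex F
    (one_mem_strictPeriods (p := p))
  have h1 := tendsto_cuspFunction_zero one_pos (mod_cast hper) F.holo'
    (ModularFormClass.bdd_at_infty F)
  simpa [qExpansion_coeff] using h1

lemma mdifferentiable_slash {F : ℍ → ℂ} (hF : MDiff F) (k : ℤ) (γ : SL(2, ℤ)) :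
    MDiff (F ∣[k] γ) := by
  exact hF.slash k (γ : GL (Fin 2) ℝ)

/-- Every modular form for `Γ₀(p)` has a value at the cusp `0`. -/
lemma exists_tendsto_slash_S (F : ModularForm (Gam0 p) k) :
    ∃ b, Tendsto ((F : ℍ → ℂ) ∣[k] ModularGroup.S) atImInfty (𝓝 b) := by
  have hp : (0 : ℝ) < p := by exact_mod_cast (Fact.out : p.Prime).pos
  refine ⟨_, tendsto_cuspFunction_zero hp (periodic_comp_ofComplex_of_vadd fun z ↦ ?_)
    (mdifferentiable_slash F.holo' k _) (ModularFormClass.bdd_at_infty_slash F _)⟩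
  have h := slash_eq_slash_S_mul_T_zpow (p := p) (γ := ModularGroup.S) (n := p)
    (fun γ hγ ↦ slash_eq_of_mem_Gamma0 F hγ) (by simp [ModularGroup.S])
  conv_rhs => rw [h, SlashAction.slash_mul, slash_T_zpow_apply]
  simp

lemma exists_isIntegralForm (hP : P ∈ integralForms p k) : ∃ b, IsIntegralForm p k P b := by
  obtain ⟨F, hF⟩ := hP
  obtain ⟨b, hb⟩ := exists_tendsto_slash_S F
  exact ⟨b, F, hF, hb⟩

omit [Fact p.Prime] in
lemma IsIntegralForm.mem_integralForms (h : IsIntegralForm p k P b) : P ∈ integralForms p k := by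
  obtain ⟨F, hF, -⟩ := h
  exact ⟨F, hF⟩

lemma isIntegralForm_of_mem_integralCuspForms (hP : P ∈ integralCuspForms p k) :
    IsIntegralForm p k P 0 ∧ constantCoeff P = 0 := by
  obtain ⟨F, hF⟩ := hP
  refine ⟨⟨⟨F.toSlashInvariantForm, F.holo', fun hc g hg ↦
    (F.zero_at_cusps' hc g hg).boundedAtFilter⟩, hF, ?_⟩, ?_⟩
  · exact CuspFormClass.zero_at_infty_slash F ModularGroup.S
  · have h1 := CuspFormClass.qExpansion_coeff_zero F one_pos (one_mem_strictPeriods (p := p))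
    rw [hF, PowerSeries.coeff_map] at h1
    simpa using h1

/-- A form with integral expansion that vanishes at both cusps `∞` and `0` is a cusp form. -/
lemma IsIntegralForm.mem_integralCuspForms (h : IsIntegralForm p k P 0)
    (hP : constantCoeff P = 0) : P ∈ integralCuspForms p k := by
  obtain ⟨F, hF, hb⟩ := h
  refine ⟨cuspFormOfCusps p F (fun γ hγ ↦ slash_eq_of_mem_Gamma0 F hγ) F.holo' ?_ hb, hF⟩
  have h1 := tendsto_atImInfty_coeff_zero F
  rw [hF, PowerSeries.coeff_map] at h1
  rw [PowerSeries.coeff_zero_eq_constantCoeff_apply, hP, map_zero] at h1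
  exact h1

omit [Fact p.Prime] in
lemma IsIntegralForm.cast (h : IsIntegralForm p k P b) (hk : k = l) : IsIntegralForm p l P b :=
  hk ▸ h

lemma isIntegralForm_one : IsIntegralForm p 0 1 1 := by
  refine ⟨1, ?_, ?_⟩
  · simpa using UpperHalfPlane.qExpansion_one 1
  · have : ((1 : ModularForm (Gam0 p) 0) : ℍ → ℂ) ∣[(0 : ℤ)] ModularGroup.S = 1 := by
      rw [ModularForm.one_coe_eq_one]
      ext z
      simp [SL_slash_apply]
    rw [this]
    exact tendsto_const_nhds

omit [Fact p.Prime] in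
lemma IsIntegralForm.add (h : IsIntegralForm p k P b) (h' : IsIntegralForm p k Q c) :
    IsIntegralForm p k (P + Q) (b + c) := by
  obtain ⟨F, hF, hb⟩ := h
  obtain ⟨G, hG, hc⟩ := h'
  refine ⟨F + G, ?_, ?_⟩
  · rw [FunLike.coe_add, ModularForm.qExpansion_add one_pos one_mem_strictPeriods, hF, hG, map_add]
  · rw [FunLike.coe_add, SlashAction.add_slash]
    exact hb.add hc

omit [Fact p.Prime] in
lemma IsIntegralForm.smul (h : IsIntegralForm p k P b) (n : ℤ) :
    IsIntegralForm p k (n • P) (n * b) := by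
  obtain ⟨F, hF, hb⟩ := h
  refine ⟨(n : ℂ) • F, ?_, ?_⟩
  · rw [FunLike.coe_smul, ModularForm.qExpansion_smul one_pos one_mem_strictPeriods, hF]
    rw [map_zsmul, Int.cast_smul_eq_zsmul]
  · rw [FunLike.coe_smul, ModularForm.SL_smul_slash]
    exact hb.const_mul _

lemma IsIntegralForm.mul (h : IsIntegralForm p k P b) (h' : IsIntegralForm p l Q c) :
    IsIntegralForm p (k + l) (P * Q) (b * c) := by
  obtain ⟨F, hF, hb⟩ := h
  obtain ⟨G, hG, hc⟩ := h'
  refine ⟨F.mul G, ?_, ?_⟩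
  · rw [ModularForm.qExpansion_mul one_pos one_mem_strictPeriods, hF, hG, map_mul]
  · rw [ModularForm.coe_mul, ModularForm.mul_slash_SL2]
    exact hb.mul hc

lemma IsIntegralForm.pow (h : IsIntegralForm p k P b) (n : ℕ) :
    IsIntegralForm p (n * k) (P ^ n) (b ^ n) := by
  induction n with
  | zero => simpa using isIntegralForm_one
  | succ n ih =>
    rw [pow_succ, pow_succ]
    exact (ih.mul h).cast (by push_cast; ring)

omit [Fact p.Prime] in
/-- Forms of odd weight vanish, since `-1 ∈ Γ₀(p)`. -/
lemma eq_zero_of_mem_integralForms_of_odd (hk : Odd k) (hP : P ∈ integralForms p k) : P = 0 := by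
  obtain ⟨F, hF⟩ := hP
  have hneg : (-1 : GL (Fin 2) ℝ) ∈ Gam0 p :=
    Subgroup.mem_map.mpr ⟨-1, mem_Gamma0_iff_dvd.mpr (by simp), by ext; simp⟩
  have hF0 : F = 0 := ModularForm.eq_zero_of_neg_one_mem hneg hk F
  rw [hF0, FunLike.coe_zero, qExpansion_zero] at hF
  ext m
  have := congrArg (coeff m) hF
  simpa using this.symm

end IntegralForms

/-! ### The map `F(z) ↦ F(p z)` from level one to level `p` -/

section Degeneracy

variable (p : ℕ) [Fact p.Prime] {k l : ℤ} {P Q : PowerSeries ℤ}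

lemma cast_prime_ne_zero : (p : ℝ) ≠ 0 := by exact_mod_cast (Fact.out : p.Prime).ne_zero

/-- The matrix `diag(p, 1)`, acting on the upper half plane by `z ↦ p z`. -/
def mulMatrix : GL (Fin 2) ℝ :=
  .mkOfDetNeZero !![(p : ℝ), 0; 0, 1] (by simpa using cast_prime_ne_zero p)

/-- The matrix `diag(1, p)`, acting on the upper half plane by `z ↦ z / p`. -/
def divMatrix : GL (Fin 2) ℝ :=
  .mkOfDetNeZero !![1, 0; 0, (p : ℝ)] (by simpa using cast_prime_ne_zero p)

lemma det_mulMatrix : (mulMatrix p).det.val = p := by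
  simp [mulMatrix, Matrix.GeneralLinearGroup.mkOfDetNeZero, Matrix.GeneralLinearGroup.val_det_apply]

lemma det_divMatrix : (divMatrix p).det.val = p := by
  simp [divMatrix, Matrix.GeneralLinearGroup.mkOfDetNeZero, Matrix.GeneralLinearGroup.val_det_apply]

lemma cast_prime_pos : (0 : ℝ) < p := by exact_mod_cast (Fact.out : p.Prime).pos

lemma coe_mulMatrix_smul (z : ℍ) : ((mulMatrix p • z : ℍ) : ℂ) = p * z := by
  rw [coe_smul_of_det_pos (by rw [det_mulMatrix]; exact cast_prime_pos p)]
  simp [num, denom, mulMatrix, Matrix.GeneralLinearGroup.mkOfDetNeZero]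

lemma slash_mulMatrix_apply (F : ℍ → ℂ) (z : ℍ) :
    (F ∣[k] mulMatrix p) z = (p : ℂ) ^ (k - 1) * F (mulMatrix p • z) := by
  rw [ModularForm.slash_apply]
  have h1 : denom (mulMatrix p) z = 1 := by
    simp [denom, mulMatrix, Matrix.GeneralLinearGroup.mkOfDetNeZero]
  have h2 : σ (mulMatrix p) (F (mulMatrix p • z)) = F (mulMatrix p • z) := by
    rw [σ, if_pos (by rw [det_mulMatrix]; exact cast_prime_pos p)]
    rfl
  rw [h1, h2, det_mulMatrix, abs_of_pos (cast_prime_pos p)]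
  simp [mul_comm]

lemma slash_divMatrix_apply (F : ℍ → ℂ) (z : ℍ) :
    (F ∣[k] divMatrix p) z = (p : ℂ)⁻¹ * F (divMatrix p • z) := by
  rw [ModularForm.slash_apply]
  have h1 : denom (divMatrix p) z = p := by
    simp [denom, divMatrix, Matrix.GeneralLinearGroup.mkOfDetNeZero]
  have h2 : σ (divMatrix p) (F (divMatrix p • z)) = F (divMatrix p • z) := by
    rw [σ, if_pos (by rw [det_divMatrix]; exact cast_prime_pos p)]
    rfl
  have hp : (p : ℂ) ≠ 0 := by exact_mod_cast (Fact.out : p.Prime).ne_zero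
  rw [h1, h2, det_divMatrix, abs_of_pos (cast_prime_pos p)]
  push_cast
  rw [zpow_sub_one₀ hp, zpow_neg]
  have := zpow_ne_zero k hp
  field_simp

/-- `diag(p, 1)` conjugates `Γ₀(p)` into `SL₂(ℤ)`. -/
lemma exists_mulMatrix_mul_eq {γ : SL(2, ℤ)} (hγ : γ ∈ Gamma0 p) :
    ∃ γ' : SL(2, ℤ), mulMatrix p * (γ : GL (Fin 2) ℝ) = (γ' : GL (Fin 2) ℝ) * mulMatrix p ∧
      (p : ℤ) * γ' 1 0 = γ 1 0 ∧ γ' 1 1 = γ 1 1 := by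
  obtain ⟨c, hc⟩ := mem_Gamma0_iff_dvd.mp hγ
  have hdet : γ 0 0 * γ 1 1 - γ 0 1 * γ 1 0 = 1 := by
    rw [← Matrix.det_fin_two]; exact γ.det_coe
  obtain ⟨γ', h00, h01, h10, h11⟩ : ∃ γ' : SL(2, ℤ),
      γ' 0 0 = γ 0 0 ∧ γ' 0 1 = p * γ 0 1 ∧ γ' 1 0 = c ∧ γ' 1 1 = γ 1 1 :=
    ⟨⟨!![γ 0 0, p * γ 0 1; c, γ 1 1], by
      rw [Matrix.det_fin_two_of]
      linear_combination hdet + γ 0 1 * hc⟩, rfl, rfl, rfl, rfl⟩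
  refine ⟨γ', ?_, by rw [h10, hc], h11⟩
  ext i j
  fin_cases i <;> fin_cases j <;>
    simp [mulMatrix, Matrix.GeneralLinearGroup.mkOfDetNeZero, Matrix.mul_apply,
      Fin.sum_univ_two, h00, h01, h10, h11, hc, mul_comm]

lemma mulMatrix_mul_S :
    mulMatrix p * ((ModularGroup.S : SL(2, ℤ)) : GL (Fin 2) ℝ) =
      ((ModularGroup.S : SL(2, ℤ)) : GL (Fin 2) ℝ) * divMatrix p := by
  ext i j
  fin_cases i <;> fin_cases j <;>
    simp [mulMatrix, divMatrix, Matrix.GeneralLinearGroup.mkOfDetNeZero, Matrix.mul_apply,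
      Fin.sum_univ_two]

lemma slash_mulMatrix_slash_S (F : ℍ → ℂ) :
    (F ∣[k] mulMatrix p) ∣[k] ModularGroup.S = (F ∣[k] ModularGroup.S) ∣[k] divMatrix p := by
  rw [SL_slash, SL_slash, ← SlashAction.slash_mul, ← SlashAction.slash_mul, mulMatrix_mul_S]

lemma slash_mulMatrix_of_levelOne {F : ℍ → ℂ} (hF : ∀ γ : SL(2, ℤ), F ∣[k] γ = F)
    {γ : SL(2, ℤ)} (hγ : γ ∈ Gamma0 p) : (F ∣[k] mulMatrix p) ∣[k] γ = F ∣[k] mulMatrix p := by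
  obtain ⟨γ', h, -, -⟩ := exists_mulMatrix_mul_eq p hγ
  rw [SL_slash, ← SlashAction.slash_mul, h, SlashAction.slash_mul, ← SL_slash, hF]

lemma tendsto_divMatrix_smul : Tendsto (fun z : ℍ ↦ divMatrix p • z) atImInfty atImInfty :=
  tendsto_smul_atImInfty (by simp [divMatrix, Matrix.GeneralLinearGroup.mkOfDetNeZero])

lemma tendsto_mulMatrix_smul : Tendsto (fun z : ℍ ↦ mulMatrix p • z) atImInfty atImInfty :=
  tendsto_smul_atImInfty (by simp [mulMatrix, Matrix.GeneralLinearGroup.mkOfDetNeZero])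

lemma tendsto_slash_mulMatrix_slash_S {F : ℍ → ℂ} {a : ℂ} (hF : F ∣[k] ModularGroup.S = F)
    (ha : Tendsto F atImInfty (𝓝 a)) :
    Tendsto ((F ∣[k] mulMatrix p) ∣[k] ModularGroup.S) atImInfty (𝓝 ((p : ℂ)⁻¹ * a)) := by
  rw [slash_mulMatrix_slash_S, hF]
  refine ((ha.comp (tendsto_divMatrix_smul p)).const_mul _).congr fun z ↦ ?_
  rw [slash_divMatrix_apply, Function.comp_apply]

lemma qParam_mulMatrix_smul (z : ℍ) : 𝕢 1 ((mulMatrix p • z : ℍ) : ℂ) = 𝕢 1 (z : ℂ) ^ p := by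
  rw [coe_mulMatrix_smul, Function.Periodic.qParam, Function.Periodic.qParam, ← Complex.exp_nat_mul]
  congr 1
  push_cast
  ring

lemma prime_ne_zero : p ≠ 0 := (Fact.out : p.Prime).ne_zero

lemma hasSum_expand {c : PowerSeries ℂ} {q a : ℂ}
    (h : HasSum (fun m ↦ coeff m c * (q ^ p) ^ m) a) :
    HasSum (fun m ↦ coeff m (c.expand p (prime_ne_zero p)) * q ^ m) a := by
  have hinj : Function.Injective fun m : ℕ ↦ p * m :=
    fun _ _ h ↦ Nat.eq_of_mul_eq_mul_left (Fact.out : p.Prime).pos h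
  rw [← hinj.hasSum_iff]
  · convert h using 2 with m
    simp [Function.comp_apply, coeff_expand_mul, pow_mul]
  · intro m hm
    rw [coeff_expand_of_not_dvd, zero_mul]
    rintro ⟨r, rfl⟩
    exact hm ⟨r, rfl⟩

end Degeneracy

/-! ### Level one forms with integral expansion -/

section LevelOne

variable {p : ℕ} [Fact p.Prime] {k l : ℤ} {P Q : PowerSeries ℤ}

/-- `P` is the `q`-expansion of a modular form of weight `k` for `SL₂(ℤ)`. -/
def IsLevelOneForm (k : ℤ) (P : PowerSeries ℤ) : Prop :=
  ∃ F : ModularForm 𝒮ℒ k, qExpansion 1 F = PowerSeries.map (Int.castRingHom ℂ) P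

lemma IsLevelOneForm.cast (h : IsLevelOneForm k P) (hk : k = l) : IsLevelOneForm l P := hk ▸ h

lemma isLevelOneForm_one : IsLevelOneForm 0 1 :=
  ⟨1, by simpa using UpperHalfPlane.qExpansion_one 1⟩

lemma IsLevelOneForm.mul (h : IsLevelOneForm k P) (h' : IsLevelOneForm l Q) :
    IsLevelOneForm (k + l) (P * Q) := by
  obtain ⟨F, hF⟩ := h
  obtain ⟨G, hG⟩ := h'
  exact ⟨F.mul G, by
    rw [ModularForm.qExpansion_mul one_pos one_mem_strictPeriods_SL, hF, hG, map_mul]⟩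

lemma IsLevelOneForm.pow (h : IsLevelOneForm k P) (n : ℕ) : IsLevelOneForm (n * k) (P ^ n) := by
  induction n with
  | zero => simpa using isLevelOneForm_one
  | succ n ih =>
    rw [pow_succ]
    exact (ih.mul h).cast (by push_cast; ring)

lemma slash_levelOne (F : ModularForm 𝒮ℒ k) (γ : SL(2, ℤ)) : (F : ℍ → ℂ) ∣[k] γ = F :=
  SlashInvariantForm.slash_action_eqn F _ ⟨γ, rfl⟩

lemma tendsto_levelOne (F : ModularForm 𝒮ℒ k) :
    Tendsto F atImInfty (𝓝 ((qExpansion 1 F).coeff 0)) := by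
  have hper := SlashInvariantFormClass.periodic_comp_ofComplex F one_mem_strictPeriods_SL
  have h1 := tendsto_cuspFunction_zero one_pos (mod_cast hper) F.holo'
    (ModularFormClass.bdd_at_infty F)
  simpa [qExpansion_coeff] using h1

variable (p) in
/-- A level one form takes the same value at both cusps of `Γ₀(p)`. -/
lemma IsLevelOneForm.isIntegralForm (h : IsLevelOneForm k P) :
    IsIntegralForm p k P (constantCoeff P : ℤ) := by
  obtain ⟨F, hF⟩ := h
  have ht := tendsto_levelOne F
  rw [hF, PowerSeries.coeff_map] at ht
  have hS : Tendsto ((F : ℍ → ℂ) ∣[k] ModularGroup.S) atImInfty (𝓝 (constantCoeff P : ℤ)) := by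
    rw [slash_levelOne]
    simpa using ht
  exact ⟨modularFormOfCusps p F _ (fun γ _ ↦ slash_levelOne F γ) F.holo'
    (ModularFormClass.bdd_at_infty F) hS, hF, hS⟩

variable (p) in
/-- If `F` has level one and weight `k`, then `F(p z)` has value `p ^ (-k) F(∞)` at `0`. -/
lemma IsLevelOneForm.isIntegralForm_expand (h : IsLevelOneForm k P) :
    IsIntegralForm p k (P.expand p (prime_ne_zero p)) ((p : ℂ) ^ (-k) * (constantCoeff P : ℤ)) := by
  obtain ⟨F, hF⟩ := h
  have hp : (p : ℂ) ≠ 0 := by exact_mod_cast prime_ne_zero p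
  have ht := tendsto_levelOne F
  rw [hF, PowerSeries.coeff_map] at ht
  set W : ℍ → ℂ := (p : ℂ) ^ (1 - k) • ((F : ℍ → ℂ) ∣[k] mulMatrix p) with hW
  have hWz (z : ℍ) : W z = F (mulMatrix p • z) := by
    rw [hW, Pi.smul_apply, slash_mulMatrix_apply, smul_eq_mul, ← mul_assoc, ← zpow_add₀ hp]
    simp
  have hinv : ∀ γ ∈ Gamma0 p, W ∣[k] γ = W := fun γ hγ ↦ by
    rw [hW, SL_smul_slash, slash_mulMatrix_of_levelOne p (slash_levelOne F) hγ]
  have hol : MDiff W := (F.holo'.slash k (mulMatrix p)).const_smul _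
  have hS : Tendsto (W ∣[k] ModularGroup.S) atImInfty
      (𝓝 ((p : ℂ) ^ (-k) * (constantCoeff P : ℤ))) := by
    have h1 := (tendsto_slash_mulMatrix_slash_S p (slash_levelOne F ModularGroup.S) ht).const_smul
      ((p : ℂ) ^ (1 - k))
    rw [hW, SL_smul_slash]
    have h2 : (p : ℂ) ^ (1 - k) • ((p : ℂ)⁻¹ * (Int.castRingHom ℂ) (coeff 0 P)) =
        (p : ℂ) ^ (-k) * (constantCoeff P : ℤ) := by
      rw [smul_eq_mul, ← mul_assoc, ← zpow_sub_one₀ hp]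
      simp
    rw [← h2]
    exact h1
  have hinf : Tendsto W atImInfty (𝓝 ((coeff 0 P : ℤ) : ℂ)) :=
    (ht.comp (tendsto_mulMatrix_smul p)).congr fun z ↦ (hWz z).symm
  let G := modularFormOfCusps p W _ hinv hol (isBoundedAtImInfty_of_tendsto hinf) hS
  refine ⟨G, ?_, hS⟩
  ext m
  symm
  refine ModularFormClass.qExpansion_coeff_unique (f := G)
    (c := fun m ↦ coeff m (map (Int.castRingHom ℂ) (P.expand p (prime_ne_zero p))))
    one_pos one_mem_strictPeriods (fun z ↦ ?_) m
  have h2 := ModularForm.hasSum_qExpansion F one_pos one_mem_strictPeriods_SL (mulMatrix p • z)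
  rw [qParam_mulMatrix_smul, hF, ← hWz] at h2
  rw [PowerSeries.map_expand]
  exact hasSum_expand p h2

end LevelOne

/-! ### Eisenstein series and the discriminant -/

section Eisenstein

open scoped ArithmeticFunction.sigma

/-- The power series `∑_{m ≥ 1} σ_j(m) X ^ m`. -/
def sigmaSeries (j : ℕ) : PowerSeries ℤ := .mk fun m ↦ (σ j m : ℤ)

lemma constantCoeff_sigmaSeries (j : ℕ) : constantCoeff (sigmaSeries j) = 0 := by
  rw [← coeff_zero_eq_constantCoeff_apply]
  simp [sigmaSeries]

lemma smul_qExpansion_eisenstein {j : ℕ} (hj : 3 ≤ j) (hj2 : Even j) {u v : ℤ}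
    (huv : (v : ℚ) * (2 * j / bernoulli j) = u) :
    (v : ℂ) • qExpansion 1 (ModularForm.E hj) =
      map (Int.castRingHom ℂ) (C v - u • sigmaSeries (j - 1)) := by
  have huv' : (v : ℂ) * (2 * j / bernoulli j) = u := by
    exact_mod_cast congrArg (Rat.cast (K := ℂ)) huv
  ext m
  rw [PowerSeries.coeff_smul, EisensteinSeries.E_qExpansion_coeff hj hj2, PowerSeries.coeff_map,
    map_sub, PowerSeries.coeff_C, map_zsmul, sigmaSeries, coeff_mk]
  split_ifs with hm
  · simp [hm]
  · simp only [smul_eq_mul, zero_sub, map_neg, map_mul, eq_intCast, ← huv']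
    push_cast
    ring

/-- The Eisenstein series of weight `j`, scaled by an integer `v` clearing the denominator of
`2 j / B_j`. -/
lemma isLevelOneForm_eisenstein {j : ℕ} (hj : 3 ≤ j) (hj2 : Even j) {u v : ℤ}
    (huv : (v : ℚ) * (2 * j / bernoulli j) = u) :
    IsLevelOneForm j (C v - u • sigmaSeries (j - 1)) := by
  refine ⟨(v : ℂ) • ModularForm.E hj, ?_⟩
  rw [FunLike.coe_smul, ModularForm.qExpansion_smul one_pos one_mem_strictPeriods_SL,
    smul_qExpansion_eisenstein hj hj2 huv]

/-- The `q`-expansion of `E₄`. -/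
def eisFour : PowerSeries ℤ := 1 + 240 * sigmaSeries 3

/-- The `q`-expansion of `E₆`. -/
def eisSix : PowerSeries ℤ := 1 - 504 * sigmaSeries 5

lemma qExpansion_E₄ : qExpansion 1 E₄ = map (Int.castRingHom ℂ) eisFour := by
  have h := smul_qExpansion_eisenstein (j := 4) (by norm_num) ⟨2, rfl⟩ (u := -240) (v := 1)
    (by norm_num [show bernoulli 4 = -1 / 30 by decide +kernel])
  rw [Int.cast_one, one_smul] at h
  rw [h, eisFour]
  congr 1
  simp

lemma qExpansion_E₆ : qExpansion 1 E₆ = map (Int.castRingHom ℂ) eisSix := by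
  have h := smul_qExpansion_eisenstein (j := 6) (by norm_num) ⟨3, rfl⟩ (u := 504) (v := 1)
    (by norm_num [show bernoulli 6 = 1 / 42 by decide +kernel])
  rw [Int.cast_one, one_smul] at h
  rw [h, eisSix]
  congr 1
  simp

lemma isLevelOneForm_eisFour : IsLevelOneForm 4 eisFour := ⟨E₄, qExpansion_E₄⟩

lemma isLevelOneForm_eisSix : IsLevelOneForm 6 eisSix := ⟨E₆, qExpansion_E₆⟩

lemma constantCoeff_eisFour : constantCoeff eisFour = 1 := by
  simp [eisFour, constantCoeff_sigmaSeries]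

lemma constantCoeff_eisSix : constantCoeff eisSix = 1 := by
  simp [eisSix, constantCoeff_sigmaSeries]

/-- In every even weight `w ≥ 4` some `E₄ ^ a * E₆ ^ b` is an integral form with constant
term `1`. -/
lemma exists_isLevelOneForm {w : ℕ} (hw : 4 ≤ w) (hw2 : Even w) :
    ∃ P, IsLevelOneForm w P ∧ constantCoeff P = 1 := by
  obtain ⟨n, rfl⟩ := hw2
  rcases Nat.even_or_odd' n with ⟨a, rfl | rfl⟩
  · exact ⟨eisFour ^ a, (isLevelOneForm_eisFour.pow a).cast (by push_cast; ring), by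
      simp [constantCoeff_eisFour]⟩
  · obtain ⟨a, rfl⟩ : ∃ a', a = a' + 1 := ⟨a - 1, by omega⟩
    exact ⟨eisFour ^ a * eisSix, ((isLevelOneForm_eisFour.pow a).mul isLevelOneForm_eisSix).cast
      (by push_cast; ring), by simp [constantCoeff_eisFour, constantCoeff_eisSix]⟩

/-- The congruence `12 ∣ 5 σ₃(m) + 7 σ₅(m)`. -/
lemma exists_sigma_combination :
    ∃ W : PowerSeries ℤ, 5 * sigmaSeries 3 + 7 * sigmaSeries 5 = 12 * W := by
  have hdvd (m : ℕ) : (12 : ℤ) ∣ 5 * σ 3 m + 7 * σ 5 m := by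
    rw [ArithmeticFunction.sigma_apply, ArithmeticFunction.sigma_apply]
    push_cast
    rw [Finset.mul_sum, Finset.mul_sum, ← Finset.sum_add_distrib]
    refine Finset.dvd_sum fun d _ ↦ ?_
    have h (x : ZMod 12) : 5 * x ^ 3 + 7 * x ^ 5 = 0 := by revert x; decide
    refine (ZMod.intCast_zmod_eq_zero_iff_dvd _ 12).mp ?_
    push_cast
    exact h _
  choose w hw using hdvd
  refine ⟨.mk w, ?_⟩
  ext m
  rw [show (5 : PowerSeries ℤ) = C 5 from rfl, show (7 : PowerSeries ℤ) = C 7 from rfl,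
    show (12 : PowerSeries ℤ) = C 12 from rfl]
  simp only [map_add, coeff_C_mul, sigmaSeries, coeff_mk]
  exact hw m

/-- The discriminant has an integral `q`-expansion `q + O(q²)`. Integrality follows from
`1728 Δ = E₄ ^ 3 - E₆ ^ 2` and `12 ∣ 5 d ^ 3 + 7 d ^ 5`. -/
lemma exists_qExpansion_discriminant :
    ∃ D : PowerSeries ℤ, qExpansion 1 CuspForm.discriminant =
      map (Int.castRingHom ℂ) (X * D) ∧ constantCoeff D = 1 := by
  obtain ⟨W, hW⟩ := exists_sigma_combination
  set A := sigmaSeries 3 with hA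
  set B := sigmaSeries 5 with hB
  set D := 100 * A ^ 2 + 8000 * A ^ 3 - 147 * B ^ 2 + W with hD
  have hD1 : 1728 * D = eisFour ^ 3 - eisSix ^ 2 := by
    rw [eisFour, eisSix, ← hA, ← hB, hD]
    linear_combination -144 * hW
  have hq : qExpansion 1 CuspForm.discriminant = map (Int.castRingHom ℂ) D := by
    have hfun : ((1728 : ℂ) • CuspForm.discriminant : ℍ → ℂ) =
        (ModularForm.mcast (by decide) (E₄.pow 3) - ModularForm.mcast (by decide) (E₆.pow 2) :
          ModularForm 𝒮ℒ 12) := by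
      ext z
      simp only [Pi.smul_apply, CuspForm.coe_discriminant, discriminant_eq_E₄_cube_sub_E₆_sq,
        coe_mcast, ModularForm.coe_pow, sub_apply, Pi.pow_apply, smul_eq_mul]
      ring
    have h1 := congrArg (qExpansion 1) hfun
    rw [ModularForm.qExpansion_smul one_pos one_mem_strictPeriods_SL, FunLike.coe_sub,
      ModularForm.qExpansion_sub one_pos one_mem_strictPeriods_SL, coe_mcast, coe_mcast,
      ModularForm.qExpansion_pow one_pos one_mem_strictPeriods_SL,
      ModularForm.qExpansion_pow one_pos one_mem_strictPeriods_SL, qExpansion_E₄, qExpansion_E₆,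
      ← map_pow, ← map_pow, ← map_sub, ← hD1] at h1
    ext m
    have h2 := congrArg (coeff m) h1
    rw [show (1728 : PowerSeries ℤ) = C 1728 from rfl, PowerSeries.coeff_smul,
      PowerSeries.coeff_map, coeff_C_mul] at h2
    simpa using h2
  have hD0 : coeff 0 D = 0 := by
    have h := CuspFormClass.qExpansion_coeff_zero CuspForm.discriminant one_pos
      one_mem_strictPeriods_SL
    rw [hq, PowerSeries.coeff_map, eq_intCast] at h
    exact_mod_cast h
  have hD1 : coeff 1 D = 1 := by
    have h := discriminant_qExpansion_coeff_one
    rw [← CuspForm.coe_discriminant, hq, PowerSeries.coeff_map, eq_intCast] at h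
    exact_mod_cast h
  obtain ⟨D', hD'⟩ := X_dvd_iff.mpr (by simpa using hD0)
  refine ⟨D', by rw [hq, hD'], ?_⟩
  rw [hD', show (1 : ℕ) = 0 + 1 from rfl, coeff_succ_X_mul] at hD1
  simpa using hD1

/-- By the theorem of von Staudt and Clausen `p B_{p-1}` is a `p`-adic unit, so that the
coefficient `2 (p - 1) / B_{p-1}` of the Eisenstein series is divisible by `p`. -/
lemma exists_bernoulli_eq (p : ℕ) [Fact p.Prime] (hp : 3 < p) :
    ∃ u v : ℤ, ¬ (p : ℤ) ∣ v ∧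
      (v : ℚ) * (2 * (p - 1 : ℕ) / bernoulli (p - 1)) = (p * u : ℤ) := by
  have hpp := (Fact.out : p.Prime)
  obtain ⟨k, hk⟩ : ∃ k, p - 1 = 2 * k := by
    obtain ⟨k, hk⟩ := hpp.odd_of_ne_two (by omega)
    exact ⟨k, by omega⟩
  obtain ⟨N, hN⟩ := Bernoulli.vonStaudt_clausen k
  set s := {q ∈ Finset.range (2 * k + 2) | q.Prime ∧ (q - 1) ∣ 2 * k} with hs
  have hps : p ∈ s := by
    simp only [hs, Finset.mem_filter, Finset.mem_range]
    exact ⟨by omega, hpp, by rw [hk]⟩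
  set D : ℤ := ∏ q ∈ s.erase p, (q : ℤ) with hD
  have hpD : ¬ (p : ℤ) ∣ D := by
    rw [hD, (Nat.prime_iff_prime_int.mp hpp).dvd_finsetProd_iff]
    rintro ⟨q, hq, hpq⟩
    obtain ⟨hqp, hq⟩ := Finset.mem_erase.mp hq
    have hq' := (Finset.mem_filter.mp hq).2.1
    exact hqp ((Nat.prime_dvd_prime_iff_eq hpp hq').mp (by exact_mod_cast hpq)).symm
  set t : ℤ := ∑ q ∈ s.erase p, ∏ r ∈ (s.erase p).erase q, (r : ℤ) with ht
  have hDt : (D : ℚ) * ∑ q ∈ s.erase p, (1 : ℚ) / q = t := by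
    rw [ht, Finset.mul_sum]
    push_cast
    refine Finset.sum_congr rfl fun q hq ↦ ?_
    have hq0 : (q : ℚ) ≠ 0 := by
      exact_mod_cast (Finset.mem_filter.mp (Finset.mem_of_mem_erase hq)).2.1.ne_zero
    rw [hD, ← Finset.mul_prod_erase _ _ hq]
    push_cast
    field_simp
  have hp0 : (p : ℚ) ≠ 0 := by exact_mod_cast hpp.ne_zero
  rw [← Finset.add_sum_erase _ _ hps] at hN
  set w : ℤ := p * (D * N - t) - D with hw
  have hwB : (w : ℚ) = p * D * bernoulli (2 * k) := by
    rw [hw]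
    push_cast
    rw [hN, ← hDt]
    field_simp
    ring
  have hpw : ¬ (p : ℤ) ∣ w := fun h ↦ hpD <| by
    have := (dvd_mul_right (p : ℤ) (D * N - t)).sub h
    simpa [hw] using this
  have hB : bernoulli (2 * k) ≠ 0 := fun h ↦ hpw <| by
    rw [h, mul_zero] at hwB
    rw [Int.cast_eq_zero.mp hwB]
    exact dvd_zero _
  refine ⟨D * (2 * (2 * k)), w, hpw, ?_⟩
  rw [hk, hwB]
  push_cast
  field_simp

/-- The Hasse invariant lifts to level one: up to a factor `v` prime to `p`, the Eisenstein series
of weight `p - 1` is integral and congruent to a constant modulo `p`. -/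
lemma exists_isLevelOneForm_hasse (p : ℕ) [Fact p.Prime] (hp : 3 < p) :
    ∃ (v : ℤ) (Q : PowerSeries ℤ), ¬ (p : ℤ) ∣ v ∧ constantCoeff Q = 0 ∧
      IsLevelOneForm (p - 1) (C v + (p : ℤ) • Q) := by
  obtain ⟨u, v, hv, huv⟩ := exists_bernoulli_eq p hp
  have hpp := (Fact.out : p.Prime)
  refine ⟨v, -u • sigmaSeries (p - 1 - 1), hv, ?_, ?_⟩
  · rw [← coeff_zero_eq_constantCoeff_apply, map_zsmul, coeff_zero_eq_constantCoeff_apply,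
      constantCoeff_sigmaSeries, smul_zero]
  · have h := isLevelOneForm_eisenstein (j := p - 1) (by omega)
      (hpp.even_sub_one (by omega)) huv
    rw [smul_smul, mul_neg, _root_.neg_smul, ← sub_eq_add_neg]
    exact h.cast (by rw [Nat.cast_sub hpp.one_le]; simp)

end Eisenstein

/-! ### Analytic facts about `q`-expansions and the derivative -/

section QExpansion

open Derivative EisensteinSeries
open scoped ArithmeticFunction.sigma

variable {f : ℍ → ℂ} {c : PowerSeries ℂ}

lemma hasSum_of_forall_eq {u v : ℕ → ℂ} {a : ℂ} (h : HasSum v a) (huv : ∀ m, u m = v m) :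
    HasSum u a :=
  (funext huv) ▸ h

lemma vadd_eq_of_hasSum (h : ∀ z : ℍ, HasSum (fun m ↦ coeff m c * 𝕢 1 z ^ m) (f z)) (z : ℍ) :
    f ((1 : ℝ) +ᵥ z) = f z := by
  refine (h _).unique ?_
  refine hasSum_of_forall_eq (h z) fun m ↦ ?_
  rw [coe_vadd, add_comm]
  simp [Function.Periodic.qParam, mul_add, Complex.exp_add]

lemma analyticAt_cuspFunction_of_hasSum (hf : MDiff f)
    (h : ∀ z : ℍ, HasSum (fun m ↦ coeff m c * 𝕢 1 z ^ m) (f z)) :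
    AnalyticAt ℂ (cuspFunction 1 f) 0 :=
  analyticAt_cuspFunction_zero one_pos
    (periodic_comp_ofComplex_of_vadd (vadd_eq_of_hasSum h)) hf
    (isBoundedAtImInfty_of_hasSum_qExpansion one_pos h)

lemma qExpansion_eq_of_hasSum (hf : MDiff f)
    (h : ∀ z : ℍ, HasSum (fun m ↦ coeff m c * 𝕢 1 z ^ m) (f z)) : qExpansion 1 f = c := by
  ext m
  let : FunLike (ℍ → ℂ) ℍ ℂ := ⟨id, fun _ _ h ↦ h⟩
  exact (UpperHalfPlane.qExpansion_coeff_unique (F := ℍ → ℂ) f (c := fun m ↦ coeff m c) one_pos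
    (analyticAt_cuspFunction_of_hasSum hf h) h m).symm

lemma tendsto_of_hasSum (hf : MDiff f)
    (h : ∀ z : ℍ, HasSum (fun m ↦ coeff m c * 𝕢 1 z ^ m) (f z)) :
    Tendsto f atImInfty (𝓝 (constantCoeff c)) := by
  have h1 := tendsto_cuspFunction_zero one_pos
    (periodic_comp_ofComplex_of_vadd (vadd_eq_of_hasSum h)) hf
    (isBoundedAtImInfty_of_hasSum_qExpansion one_pos h)
  have h2 : cuspFunction 1 f 0 = constantCoeff c := by
    rw [← qExpansion_eq_of_hasSum hf h, ← coeff_zero_eq_constantCoeff_apply, qExpansion_coeff]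
    simp
  rwa [h2] at h1

/-- The normalized derivative acts on `q`-expansions as `q d/dq`. -/
lemma hasSum_normalizedDeriv (hper : Function.Periodic (f ∘ ofComplex) 1) (hf : MDiff f)
    (hb : IsBoundedAtImInfty f) (z : ℍ) :
    HasSum (fun m ↦ coeff m (X * PowerSeries.derivative ℂ (qExpansion 1 f)) * 𝕢 1 z ^ m)
      (D f z) := by
  have hper' : Function.Periodic (f ∘ ofComplex) (1 : ℝ) := mod_cast hper
  set C := cuspFunction 1 f with hC
  have hdiff : DifferentiableOn ℂ C (Metric.ball 0 1) :=
    differentiableOn_cuspFunction_ball one_pos hper' hf hb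
  have hq (w : ℍ) : 𝕢 1 (w : ℂ) ∈ Metric.ball (0 : ℂ) 1 := by
    simpa using Function.Periodic.norm_qParam_lt_one one_pos w.im_pos
  have hderiv : HasSum (fun n : ℕ ↦ coeff (n + 1) (qExpansion 1 f) * (n + 1) * 𝕢 1 z ^ n)
      (deriv C (𝕢 1 z)) := by
    refine hasSum_of_forall_eq
      (Complex.hasSum_taylorSeries_on_ball (hdiff.deriv Metric.isOpen_ball) (hq z)) fun n ↦ ?_
    rw [qExpansion_coeff, sub_zero, smul_eq_mul, smul_eq_mul, ← hC, ← iteratedDeriv_succ',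
      Nat.factorial_succ]
    have : (n.factorial : ℂ) ≠ 0 := by exact_mod_cast n.factorial_ne_zero
    have : (n + 1 : ℂ) ≠ 0 := by exact_mod_cast n.succ_ne_zero
    push_cast
    field_simp
  have hD : D f z = 𝕢 1 z * deriv C (𝕢 1 z) := by
    have hev : f ∘ ofComplex =ᶠ[𝓝 (z : ℂ)] fun w ↦ C (𝕢 1 w) := by
      filter_upwards [isOpen_upperHalfPlaneSet.mem_nhds z.im_pos] with w hw
      have := eq_cuspFunction (f := f) ⟨w, hw⟩ one_ne_zero hper'
      rw [Function.comp_apply, ofComplex_apply_of_im_pos hw, hC]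
      exact this.symm
    have hqd : HasDerivAt (fun w ↦ 𝕢 1 w) (2 * Real.pi * Complex.I * 𝕢 1 z) (z : ℂ) := by
      have h1 : HasDerivAt (fun w : ℂ ↦ 2 * Real.pi * Complex.I * w / (1 : ℝ))
          (2 * Real.pi * Complex.I) (z : ℂ) := by
        simpa using (hasDerivAt_id (z : ℂ)).const_mul (2 * Real.pi * Complex.I)
      exact (mul_comm (2 * Real.pi * Complex.I : ℂ) _) ▸ h1.cexp
    have hCd : HasDerivAt C (deriv C (𝕢 1 z)) (𝕢 1 z) :=
      (hdiff.differentiableAt (Metric.isOpen_ball.mem_nhds (hq z))).hasDerivAt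
    rw [normalizedDerivOfComplex, hev.deriv_eq,
      HasDerivAt.deriv (f := fun w ↦ C (𝕢 1 w)) (hCd.comp (z : ℂ) hqd)]
    have : (2 * Real.pi * Complex.I : ℂ) ≠ 0 := Complex.two_pi_I_ne_zero
    field_simp
  have h0 : ∑ i ∈ Finset.range 1,
      coeff i (X * PowerSeries.derivative ℂ (qExpansion 1 f)) * 𝕢 1 z ^ i = 0 := by simp
  rw [hD, ← hasSum_nat_add_iff' 1, h0, sub_zero]
  refine hasSum_of_forall_eq (hderiv.mul_left (𝕢 1 (z : ℂ))) fun n ↦ ?_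
  rw [coeff_succ_X_mul, PowerSeries.coeff_derivative, pow_succ]
  ring

lemma tendsto_inv_im_atImInfty : Tendsto (fun z : ℍ ↦ z.im⁻¹) atImInfty (𝓝 0) :=
  tendsto_inv_atTop_zero.comp tendsto_comap

/-- The derivative of a bounded function tends to `0` at `i∞`, by the Cauchy estimate on the disc of
radius `Im z / 2` about `z`. No periodicity is needed, so this applies to `F ∣[k] S`. -/
lemma tendsto_normalizedDeriv_zero (hf : MDiff f) (hb : IsBoundedAtImInfty f) :
    Tendsto (D f) atImInfty (𝓝 0) := by
  obtain ⟨M, A, hA⟩ := isBoundedAtImInfty_iff.mp hb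
  have hbound (z : ℍ) (hz : 2 * A ≤ z.im) :
      ‖D f z‖ ≤ ‖(2 * Real.pi * Complex.I : ℂ)⁻¹‖ * (2 * M) * z.im⁻¹ := by
    have hR : 0 < z.im / 2 := half_pos z.im_pos
    have him {w : ℂ} (hw : w ∈ Metric.closedBall (z : ℂ) (z.im / 2)) : z.im / 2 ≤ w.im := by
      rw [Metric.mem_closedBall, dist_eq_norm] at hw
      have := (abs_le.mp ((Complex.abs_im_le_norm (w - z)).trans hw)).1
      rw [Complex.sub_im, coe_im] at this
      linarith
    have hd : DiffContOnCl ℂ (f ∘ ofComplex) (Metric.ball (z : ℂ) (z.im / 2)) := by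
      refine DifferentiableOn.diffContOnCl ?_
      rw [closure_ball _ hR.ne']
      exact (UpperHalfPlane.mdifferentiable_iff.mp hf).mono fun w hw ↦ hR.trans_le (him hw)
    have h1 := Complex.norm_deriv_le_of_forall_mem_sphere_norm_le (C := M) hR hd fun w hw ↦ by
      have hw' := him (Metric.sphere_subset_closedBall hw)
      rw [Function.comp_apply, ofComplex_apply_of_im_pos (hR.trans_le hw')]
      exact hA _ (by change A ≤ w.im; linarith)
    rw [normalizedDerivOfComplex, norm_mul]
    calc _ ≤ ‖(2 * Real.pi * Complex.I : ℂ)⁻¹‖ * (M / (z.im / 2)) := by gcongr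
      _ = _ := by field_simp
  have h0 : Tendsto (fun z : ℍ ↦ ‖(2 * Real.pi * Complex.I : ℂ)⁻¹‖ * (2 * M) * z.im⁻¹)
      atImInfty (𝓝 0) := by
    have h := (tendsto_inv_im_atImInfty).const_mul (‖(2 * Real.pi * Complex.I : ℂ)⁻¹‖ * (2 * M))
    rwa [mul_zero] at h
  refine squeeze_zero_norm' ?_ h0
  filter_upwards [tendsto_comap.eventually (eventually_ge_atTop (2 * A))] with z hz
  exact hbound z hz

end QExpansion

/-! ### The Eisenstein series of weight two and the derivative in level `p` -/

section SerreDerivative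

open Derivative EisensteinSeries
open scoped ArithmeticFunction.sigma

variable {p : ℕ} [Fact p.Prime] {k : ℤ} {P : PowerSeries ℤ} {b : ℂ}

/-- The `q`-expansion of `E₂`. -/
def eisTwo : PowerSeries ℤ := 1 - 24 * sigmaSeries 1

lemma hasSum_E2 (z : ℍ) :
    HasSum (fun m ↦ coeff m (map (Int.castRingHom ℂ) eisTwo) * 𝕢 1 z ^ m) (E2 z) := by
  have hq : 𝕢 1 (z : ℂ) = Complex.exp (2 * Real.pi * Complex.I * z) := by
    simp [Function.Periodic.qParam]
  have hs := (summable_sigma_mul_cexp_pow (k := 2) (by norm_num) z).hasSum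
  have h1 : HasSum (fun m : ℕ ↦ (if m = 0 then 1 else 0 : ℂ) * 𝕢 1 (z : ℂ) ^ m) 1 := by
    convert hasSum_ite_eq 0 (1 : ℂ) using 2 with m
    split_ifs with h <;> simp [h]
  have h2 := h1.sub (hs.mul_left 24)
  have hE : E2 z = 1 - 24 * ∑' n : ℕ,
      (σ (2 - 1) n : ℂ) * Complex.exp (2 * Real.pi * Complex.I * z) ^ n := by
    rw [E2, Pi.smul_apply, G2_eq_tsum_cexp, ← tsum_zero_pnat_eq_tsum_nat hs.summable,
      riemannZeta_two]
    have : (Real.pi : ℂ) ≠ 0 := by exact_mod_cast Real.pi_ne_zero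
    simp only [smul_eq_mul, ArithmeticFunction.map_zero, Nat.cast_zero, zero_mul, zero_add,
      show 2 - 1 = 1 from rfl]
    field_simp
    ring
  rw [hE]
  refine hasSum_of_forall_eq h2 fun m ↦ ?_
  rw [PowerSeries.coeff_map, eisTwo, map_sub, coeff_one, show (24 : PowerSeries ℤ) = C 24 from rfl,
    coeff_C_mul, sigmaSeries, coeff_mk, hq]
  split_ifs with h
  · simp [h]
  · push_cast
    simp
    ring

variable (p) in
/-- The weight two Eisenstein series `E₂(z) - p E₂(p z)` of level `p`. -/
def eisTwoLevel : ℍ → ℂ := E2 - E2 ∣[(2 : ℤ)] mulMatrix p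

/-- The correction terms in the transformation laws of `E₂(z)` and `p E₂(p z)` agree on `Γ₀(p)`. -/
lemma slash_eisTwoLevel {γ : SL(2, ℤ)} (hγ : γ ∈ Gamma0 p) :
    eisTwoLevel p ∣[(2 : ℤ)] γ = eisTwoLevel p := by
  obtain ⟨γ', h, h10, h11⟩ := exists_mulMatrix_mul_eq p hγ
  have hp : (p : ℂ) ≠ 0 := by exact_mod_cast prime_ne_zero p
  have hD : D2 γ' ∣[(2 : ℤ)] mulMatrix p = D2 γ := by
    ext z
    rw [slash_mulMatrix_apply, D2, D2, ModularGroup.denom_apply, ModularGroup.denom_apply,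
      coe_mulMatrix_smul, ← h10, h11]
    push_cast
    rw [show (γ' 1 0 : ℂ) * (p * z) = p * γ' 1 0 * z by ring, zpow_one]
    ring
  have hE : (E2 ∣[(2 : ℤ)] mulMatrix p) ∣[(2 : ℤ)] γ =
      E2 ∣[(2 : ℤ)] mulMatrix p - (1 / (2 * riemannZeta 2)) • D2 γ := by
    rw [SL_slash, ← SlashAction.slash_mul, h, SlashAction.slash_mul, ← SL_slash, E2_slash_action,
      ← hD]
    ext z
    simp only [slash_mulMatrix_apply, Pi.sub_apply, Pi.smul_apply, smul_eq_mul]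
    ring
  rw [eisTwoLevel, sub_eq_add_neg, SlashAction.add_slash, SlashAction.neg_slash, hE,
    E2_slash_action]
  abel

lemma mdifferentiable_E2_mulMatrix : MDiff (E2 ∣[(2 : ℤ)] mulMatrix p) :=
  E2_mdifferentiable.slash 2 _

lemma tendsto_E2 : Tendsto E2 atImInfty (𝓝 1) := by
  have h := tendsto_of_hasSum E2_mdifferentiable hasSum_E2
  have h1 : constantCoeff (map (Int.castRingHom ℂ) eisTwo) = 1 := by
    rw [← coeff_zero_eq_constantCoeff_apply, PowerSeries.coeff_map,
      coeff_zero_eq_constantCoeff_apply, eisTwo]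
    simp [constantCoeff_sigmaSeries]
  rwa [h1] at h

lemma tendsto_eisTwoLevel_slash_S :
    Tendsto (eisTwoLevel p ∣[(2 : ℤ)] ModularGroup.S) atImInfty (𝓝 (1 - (p : ℂ)⁻¹)) := by
  have hD : Tendsto (D2 ModularGroup.S) atImInfty (𝓝 0) := by
    have h0 := tendsto_inv_im_atImInfty.const_mul ‖(2 * Real.pi * Complex.I : ℂ)‖
    rw [mul_zero] at h0
    refine squeeze_zero_norm (fun z ↦ ?_) h0
    rw [D2_S, norm_div, div_eq_mul_inv]
    gcongr
    · exact (le_abs_self _).trans (Complex.abs_im_le_norm (z : ℂ))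
  have h1 : Tendsto (E2 ∣[(2 : ℤ)] ModularGroup.S) atImInfty (𝓝 1) := by
    rw [E2_slash_action]
    have h := tendsto_E2.sub (hD.const_smul (1 / (2 * riemannZeta 2)))
    rwa [smul_zero, sub_zero] at h
  rw [eisTwoLevel, sub_eq_add_neg, SlashAction.add_slash, SlashAction.neg_slash,
    slash_mulMatrix_slash_S, ← sub_eq_add_neg]
  refine h1.sub ?_
  have h2 := (h1.comp (tendsto_divMatrix_smul p)).const_mul (p : ℂ)⁻¹
  rw [mul_one] at h2
  refine h2.congr fun z ↦ ?_
  rw [slash_divMatrix_apply, Function.comp_apply]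

lemma hasSum_E2_mulMatrix (z : ℍ) :
    HasSum (fun m ↦ coeff m (map (Int.castRingHom ℂ)
      ((p : ℤ) • eisTwo.expand p (prime_ne_zero p))) * 𝕢 1 z ^ m)
      ((E2 ∣[(2 : ℤ)] mulMatrix p) z) := by
  have h1 := hasSum_E2 (mulMatrix p • z)
  rw [qParam_mulMatrix_smul] at h1
  have h2 := (hasSum_expand p h1).mul_left (p : ℂ)
  rw [slash_mulMatrix_apply, show (2 : ℤ) - 1 = 1 by norm_num, zpow_one]
  refine hasSum_of_forall_eq h2 fun m ↦ ?_
  rw [map_zsmul, PowerSeries.map_expand, map_zsmul, zsmul_eq_mul, mul_assoc]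
  simp

/-- If `F` has weight `k`, then `12 θ F - k p E₂(p z) F`, which is
`12 ∂ F + k (E₂(z) - p E₂(p z)) F` for the Serre derivative `∂`, has weight `k + 2`. It is
congruent to `12 θ F` modulo `p`. -/
lemma IsIntegralForm.theta (h : IsIntegralForm p k P b) :
    ∃ Q, IsIntegralForm p (k + 2)
      ((12 : ℤ) • (X * PowerSeries.derivative ℤ P) + (p : ℤ) • (Q * P)) (-k * b / p) := by
  obtain ⟨F, hF, hb⟩ := h
  have hp : (p : ℂ) ≠ 0 := by exact_mod_cast prime_ne_zero p
  have hFm : MDiff (F : ℍ → ℂ) := F.holo'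
  set G : ℍ → ℂ := (12 : ℂ) • serreDerivative k F + (k : ℂ) • (eisTwoLevel p * F) with hG
  have hG' : G = (12 : ℂ) • D F + (-k : ℂ) • ((E2 ∣[(2 : ℤ)] mulMatrix p) * F) := by
    ext z
    simp only [hG, eisTwoLevel, Pi.add_apply, Pi.smul_apply, Pi.mul_apply, Pi.sub_apply,
      serreDerivative_apply, smul_eq_mul]
    ring
  have hper : Function.Periodic ((F : ℍ → ℂ) ∘ ofComplex) (1 : ℝ) :=
    SlashInvariantFormClass.periodic_comp_ofComplex F one_mem_strictPeriods
  have hFb : IsBoundedAtImInfty F := ModularFormClass.bdd_at_infty F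
  have hDs := hasSum_normalizedDeriv (mod_cast hper) hFm hFb
  have hDm : MDiff (D F) := normalizedDerivOfComplex_mdifferentiable hFm
  have hE := hasSum_E2_mulMatrix (p := p)
  have hEm := mdifferentiable_E2_mulMatrix (p := p)
  have hol : MDiff G := by
    rw [hG']
    exact (hDm.const_smul (12 : ℂ)).add ((hEm.mul hFm).const_smul (-k : ℂ))
  have hinf : IsBoundedAtImInfty G := by
    rw [hG']
    have h1 : IsBoundedAtImInfty (D F) := isBoundedAtImInfty_of_hasSum_qExpansion one_pos hDs
    have h2 : IsBoundedAtImInfty (E2 ∣[(2 : ℤ)] mulMatrix p) :=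
      isBoundedAtImInfty_of_hasSum_qExpansion one_pos hE
    exact (h1.smul (12 : ℂ)).add ((h2.mul hFb).smul (-k : ℂ))
  have hinv : ∀ γ ∈ Gamma0 p, G ∣[k + 2] γ = G := fun γ hγ ↦ by
    rw [hG, SlashAction.add_slash, SL_smul_slash, SL_smul_slash,
      serreDerivative_slash_invariant hFm (slash_eq_of_mem_Gamma0 F hγ),
      add_comm k 2, ModularForm.mul_slash_SL2, slash_eisTwoLevel hγ, slash_eq_of_mem_Gamma0 F hγ]
  have hzero : Tendsto (G ∣[k + 2] ModularGroup.S) atImInfty (𝓝 (-k * b / p)) := by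
    have hFS := mdifferentiable_slash hFm k ModularGroup.S
    have h1 := tendsto_normalizedDeriv_zero hFS (isBoundedAtImInfty_of_tendsto hb)
    have h2 := h1.sub ((tendsto_E2.const_mul ((k : ℂ) * 12⁻¹)).mul hb)
    have h3 := (h2.const_mul 12).add
      ((tendsto_eisTwoLevel_slash_S (p := p).mul hb).const_mul (k : ℂ))
    rw [hG, SlashAction.add_slash, SL_smul_slash, SL_smul_slash,
      serreDerivative_slash_equivariant hFm]
    rw [show k + 2 = 2 + k by ring, ModularForm.mul_slash_SL2]
    have h4 : -k * b / p = 12 * (0 - k * 12⁻¹ * 1 * b) + k * ((1 - (p : ℂ)⁻¹) * b) := by ring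
    rw [h4]
    exact h3
  let G' := modularFormOfCusps p G _ hinv hol hinf hzero
  refine ⟨(-k) • eisTwo.expand p (prime_ne_zero p), G', ?_, hzero⟩
  have hA1 := analyticAt_cuspFunction_of_hasSum hDm hDs
  have hA2 := analyticAt_cuspFunction_of_hasSum hEm hE
  have hA3 := analyticAt_cuspFunction_zero one_pos hper hFm hFb
  have hA12 : AnalyticAt ℂ (cuspFunction 1 ((E2 ∣[(2 : ℤ)] mulMatrix p) * F)) 0 := by
    rw [cuspFunction_mul hA2.continuousAt hA3.continuousAt]
    exact hA2.mul hA3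
  change qExpansion 1 G = _
  rw [hG', UpperHalfPlane.qExpansion_add, UpperHalfPlane.qExpansion_smul hA1,
    UpperHalfPlane.qExpansion_smul hA12, UpperHalfPlane.qExpansion_mul hA2 hA3,
    qExpansion_eq_of_hasSum hDm hDs, qExpansion_eq_of_hasSum hEm hE, hF]
  · have hder : X * PowerSeries.derivative ℂ (PowerSeries.map (Int.castRingHom ℂ) P) =
        PowerSeries.map (Int.castRingHom ℂ) (X * PowerSeries.derivative ℤ P) := by
      rw [map_mul, map_X]
      congr 1
      ext m
      simp [PowerSeries.coeff_derivative]
    have h12 (n : ℤ) (Q : PowerSeries ℂ) : (n : ℂ) • Q = n • Q := Int.cast_smul_eq_zsmul ℂ n Q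
    rw [hder, show (12 : ℂ) = ((12 : ℤ) : ℂ) by norm_num, show (-k : ℂ) = ((-k : ℤ) : ℂ) by simp,
      h12, h12, map_add, map_zsmul, map_zsmul, smul_mul_assoc, smul_mul_assoc, map_zsmul, map_zsmul,
      map_mul _ _ P, smul_comm]
  · rw [cuspFunction_smul hA1.continuousAt]
    exact hA1.const_smul
  · rw [cuspFunction_smul hA12.continuousAt]
    exact hA12.const_smul

end SerreDerivative

/-! ### The residue theorem for weight two and level one -/

section Residue

/-- A holomorphic function on the upper half plane that is invariant of weight two under `SL₂(ℤ)`
has no constant Fourier coefficient, whatever its behaviour at `i∞`: the differential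
`g(z) dz` has a primitive `Φ`; the function `Φ(-1/z) - Φ(z)` is constant and vanishes at `i`, and
the constant `Φ(z + 1) - Φ(z)` can be evaluated at the cube root of unity `ρ`, where
`ρ + 1 = -1/ρ`. -/
lemma intervalIntegral_eq_zero_of_weight_two {g : ℍ → ℂ} (hg : MDiff g)
    (hS : g ∣[(2 : ℤ)] ModularGroup.S = g) (hT : ∀ z : ℍ, g ((1 : ℝ) +ᵥ z) = g z) {Y : ℝ}
    (hY : 0 < Y) : ∫ x in (0 : ℝ)..1, (g ∘ ofComplex) (x + Y * Complex.I) = 0 := by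
  set f : ℂ → ℂ := g ∘ ofComplex with hf
  have hfd : DifferentiableOn ℂ f {z | 0 < z.im} := UpperHalfPlane.mdifferentiable_iff.mp hg
  have hfT (z : ℂ) : f (z + 1) = f z := by
    simpa [hf] using periodic_comp_ofComplex_of_vadd hT z
  have hfS {z : ℂ} (hz : 0 < z.im) : f (-z⁻¹) * (z ^ 2)⁻¹ = f z := by
    have h1 : 0 < (-z⁻¹).im := by
      have hz0 : z ≠ 0 := fun h ↦ by simp [h] at hz
      rw [Complex.neg_im, Complex.inv_im, neg_div, neg_neg]
      exact div_pos hz (Complex.normSq_pos.mpr hz0)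
    have h2 := congrFun hS ⟨z, hz⟩
    rw [SL_slash_apply, modular_S_smul, ModularGroup.denom_S] at h2
    rw [hf, Function.comp_apply, Function.comp_apply, ofComplex_apply_of_im_pos hz, ← h2,
      ofComplex_apply_of_im_pos h1]
    congr 2
    ext
    exact (inv_neg).symm
  -- the ball `|z - i R| < R` contains the path of integration, `i`, `ρ` and `ρ + 1`
  set R : ℝ := 1 + (1 + Y ^ 2) / (2 * Y) with hR
  have hR1 : 1 < R := by
    rw [hR]
    have : 0 < (1 + Y ^ 2) / (2 * Y) := by positivity
    linarith
  have hRY : 1 + Y ^ 2 < 2 * R * Y := by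
    rw [hR]
    field_simp
    nlinarith
  set B := Metric.ball ((R : ℂ) * Complex.I) R with hB
  have hmem (z : ℂ) : z ∈ B ↔ z.re ^ 2 + z.im ^ 2 < 2 * R * z.im := by
    rw [hB, Metric.mem_ball, Complex.dist_eq, ← abs_of_pos (zero_lt_one.trans hR1),
      ← sq_lt_sq₀ (norm_nonneg _) (abs_nonneg _), Complex.sq_norm, Complex.normSq_apply]
    simp only [abs_of_pos (zero_lt_one.trans hR1)]
    simp
    constructor <;> intro h <;> nlinarith
  have hBim {z : ℂ} (hz : z ∈ B) : 0 < z.im := by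
    have := (hmem z).mp hz
    by_contra! h
    nlinarith [sq_nonneg z.re, sq_nonneg z.im]
  obtain ⟨Φ, hΦ⟩ := (hfd.mono fun z hz ↦ hBim hz).isExactOn_ball
  have hBo : IsOpen B := Metric.isOpen_ball
  have hBc : Convex ℝ B := convex_ball _ _
  obtain ⟨c, hc⟩ : ∃ c, ∀ z ∈ B, z + 1 ∈ B → Φ (z + 1) - Φ z = c := by
    have hd {z : ℂ} (hz : z ∈ B ∩ (· + 1) ⁻¹' B) :
        HasDerivAt (fun z ↦ Φ (z + 1) - Φ z) 0 z := by
      have h := ((hΦ _ hz.2).comp_add_const z 1).sub (hΦ _ hz.1)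
      rwa [hfT, sub_self] at h
    obtain ⟨c, hc⟩ := (hBo.inter (hBo.preimage (continuous_add_const 1)))
      |>.exists_is_const_of_deriv_eq_zero
        (hBc.inter (hBc.translate_preimage_left 1)).isPreconnected
        (fun z hz ↦ (hd hz).differentiableAt.differentiableWithinAt) fun z hz ↦ (hd hz).deriv
    exact ⟨c, fun z hz hz1 ↦ hc z ⟨hz, hz1⟩⟩
  have hiR : (R * Complex.I).im = R := by simp
  have hinv {z : ℂ} (hz : z ∈ B) (hzi : 1 / (2 * R) < z.im) : Φ (-z⁻¹) = Φ z := by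
    set C := B ∩ {z : ℂ | 1 / (2 * R) < z.im} with hC
    have hCB {z : ℂ} (hz : z ∈ C) : -z⁻¹ ∈ B := by
      have hz0 : z ≠ 0 := fun h ↦ by simpa [h] using hBim hz.1
      have hN := Complex.normSq_pos.mpr hz0
      have hz2 : 1 < z.im * (2 * R) := (div_lt_iff₀ (by linarith)).mp hz.2
      rw [hmem, Complex.neg_re, Complex.neg_im, Complex.inv_re, Complex.inv_im]
      calc (-(z.re / Complex.normSq z)) ^ 2 + (-(-z.im / Complex.normSq z)) ^ 2
          = 1 / Complex.normSq z := by
            field_simp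
            rw [Complex.normSq_apply]
            ring
        _ < z.im * (2 * R) / Complex.normSq z := by gcongr
        _ = _ := by ring
    have hd {z : ℂ} (hz : z ∈ C) : HasDerivAt (fun z ↦ Φ (-z⁻¹) - Φ z) 0 z := by
      have hz0 : z ≠ 0 := fun h ↦ by simpa [h] using hBim hz.1
      have h := ((hΦ _ (hCB hz)).comp z (hasDerivAt_inv hz0).neg).sub (hΦ _ hz.1)
      rwa [neg_neg, hfS (hBim hz.1), sub_self] at h
    have h1 := (hBo.inter (isOpen_lt continuous_const Complex.continuous_im))
      |>.is_const_of_deriv_eq_zero (hBc.inter (convex_halfSpace_im_gt _)).isPreconnected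
      (fun z hz ↦ (hd hz).differentiableAt.differentiableWithinAt) (fun z hz ↦ (hd hz).deriv)
      (x := z) (y := Complex.I) ⟨hz, hzi⟩ ⟨(hmem _).mpr (by simp; linarith), by
        simp only [Set.mem_ofPred_eq, Complex.I_im]
        rw [div_lt_one (by linarith)]
        linarith⟩
    simpa [sub_eq_zero] using h1
  have hc0 : c = 0 := by
    obtain ⟨s, hs0, hs⟩ : ∃ s : ℝ, 1 / 2 < s ∧ s ^ 2 = 3 / 4 :=
      ⟨√3 / 2, by nlinarith [Real.sq_sqrt (show (0 : ℝ) ≤ 3 by norm_num), Real.sqrt_nonneg 3],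
        by rw [div_pow, Real.sq_sqrt (by norm_num)]; norm_num⟩
    set ρ : ℂ := ⟨-1 / 2, s⟩ with hρ
    have hρ0 : ρ ≠ 0 := fun h ↦ by simpa [hρ] using congrArg Complex.re h
    have hρ1 : ρ + 1 = -ρ⁻¹ := by
      rw [eq_neg_iff_add_eq_zero]
      field_simp
      rw [hρ]
      apply Complex.ext
      · simp
        nlinarith
      · simp
        ring
    have h1 : ρ ∈ B := (hmem ρ).mpr (by simp only [hρ]; nlinarith)
    have h2 : ρ + 1 ∈ B := (hmem _).mpr (by simp [hρ]; nlinarith)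
    rw [← hc ρ h1 h2, hρ1, hinv h1, sub_self]
    simp only [hρ]
    rw [div_lt_iff₀ (by linarith)]
    nlinarith
  have hpath {x : ℝ} (hx : x ∈ Set.Icc (0 : ℝ) 1) : (x + Y * Complex.I : ℂ) ∈ B := by
    rw [hmem]
    simp
    nlinarith [hx.1, hx.2]
  have hder {x : ℝ} (hx : x ∈ Set.Icc (0 : ℝ) 1) :
      HasDerivAt (fun x : ℝ ↦ Φ (x + Y * Complex.I)) (f (x + Y * Complex.I)) x := by
    have h := (hΦ _ (hpath hx)).comp_add_const (x : ℂ) (Y * Complex.I)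
    exact h.comp_ofReal
  have hcont : ContinuousOn (fun x : ℝ ↦ f (x + Y * Complex.I)) (Set.Icc 0 1) := by
    refine hfd.continuousOn.comp (by fun_prop) fun x hx ↦ hBim (hpath hx)
  rw [← Set.uIcc_of_le zero_le_one] at hcont hder
  rw [intervalIntegral.integral_eq_sub_of_hasDerivAt (fun x hx ↦ hder hx)
    hcont.intervalIntegrable]
  have h0 := hc (Y * Complex.I) (by simpa using hpath (x := 0) (by simp))
    (by simpa [add_comm] using hpath (x := 1) (by simp))
  rw [hc0] at h0
  simpa [add_comm] using h0

end Residue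

/-! ### The trace from level `p` to level one -/

section Trace

variable {p : ℕ} [Fact p.Prime] {k : ℤ} {g : ℍ → ℂ}

lemma slash_eq_of_cast_eq (hg : ∀ γ ∈ Gamma0 p, g ∣[k] γ = g) {γ : SL(2, ℤ)} {x : ZMod p}
    (h : (γ 1 1 : ZMod p) = x * γ 1 0) :
    g ∣[k] γ = g ∣[k] (ModularGroup.S * ModularGroup.T ^ (x.val : ℤ)) := by
  refine slash_eq_slash_S_mul_T_zpow hg ?_
  rw [← ZMod.intCast_zmod_eq_zero_iff_dvd]
  push_cast
  rw [ZMod.natCast_zmod_val, h, sub_self]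

/-- The trace to level one of a function invariant under `Γ₀(p)`, without the summand `g`. -/
def cosetSum (p : ℕ) [Fact p.Prime] (k : ℤ) (g : ℍ → ℂ) : ℍ → ℂ :=
  ∑ x : ZMod p, g ∣[k] (ModularGroup.S * ModularGroup.T ^ (x.val : ℤ))

lemma cosetSum_slash_T (hg : ∀ γ ∈ Gamma0 p, g ∣[k] γ = g) :
    cosetSum p k g ∣[k] ModularGroup.T = cosetSum p k g := by
  rw [cosetSum, SlashAction.sum_slash]
  conv_rhs => rw [← Equiv.sum_comp (Equiv.addRight (1 : ZMod p))]
  refine Finset.sum_congr rfl fun x _ ↦ ?_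
  rw [← SlashAction.slash_mul]
  refine slash_eq_of_cast_eq hg ?_
  rw [mul_assoc, ← zpow_add_one, Matrix.SpecialLinearGroup.coe_mul, ModularGroup.coe_T_zpow]
  simp [Matrix.mul_apply, Fin.sum_univ_two, ModularGroup.S]

lemma add_cosetSum_slash_S (hg : ∀ γ ∈ Gamma0 p, g ∣[k] γ = g) :
    (g + cosetSum p k g) ∣[k] ModularGroup.S = g + cosetSum p k g := by
  set h : ZMod p → ℍ → ℂ :=
    fun x ↦ g ∣[k] (ModularGroup.S * ModularGroup.T ^ (x.val : ℤ)) with hh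
  have hsum : cosetSum p k g = h 0 + ∑ x ∈ Finset.univ.erase 0, h x :=
    (Finset.add_sum_erase _ _ (Finset.mem_univ 0)).symm
  have h1 : g ∣[k] ModularGroup.S = h 0 := by simp [hh]
  have h2 : h 0 ∣[k] ModularGroup.S = g := by
    rw [← h1, ← SlashAction.slash_mul]
    exact hg _ (mem_Gamma0_iff_dvd.mpr (by
      rw [Matrix.SpecialLinearGroup.coe_mul]
      simp [ModularGroup.S]))
  have h3 {x : ZMod p} (hx : x ≠ 0) : h x ∣[k] ModularGroup.S = h (-x⁻¹) := by
    rw [hh, ← SlashAction.slash_mul]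
    refine slash_eq_of_cast_eq hg ?_
    rw [Matrix.SpecialLinearGroup.coe_mul, Matrix.SpecialLinearGroup.coe_mul,
      ModularGroup.coe_T_zpow]
    simp [Matrix.mul_apply, Fin.sum_univ_two, ModularGroup.S, hx]
  rw [SlashAction.add_slash, hsum, SlashAction.add_slash, SlashAction.sum_slash, h1, h2]
  have h4 : ∑ x ∈ Finset.univ.erase 0, h x ∣[k] ModularGroup.S =
      ∑ x ∈ Finset.univ.erase 0, h x :=
    Finset.sum_nbij' (fun x ↦ -x⁻¹) (fun x ↦ -x⁻¹) (by simp) (by simp) (by simp [inv_neg])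
      (by simp [inv_neg]) fun x hx ↦ h3 (by simpa using hx)
  rw [h4]
  abel

lemma tendsto_cosetSum {b : ℂ} (hb : Tendsto (g ∣[k] ModularGroup.S) atImInfty (𝓝 b)) :
    Tendsto (cosetSum p k g) atImInfty (𝓝 (p * b)) := by
  have h := tendsto_finsetSum (Finset.univ : Finset (ZMod p))
    fun x _ ↦ tendsto_slash_S_mul_T_zpow hb (x.val : ℤ)
  rw [Finset.sum_const, Finset.card_univ, ZMod.card, nsmul_eq_mul] at h
  refine h.congr fun z ↦ ?_
  rw [cosetSum, Finset.sum_apply]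

/-- The sum of the residues of the differential `g(z) dz` on the modular curve `X₀(p)` vanishes:
the constant Fourier coefficient at `∞` is the negative of `p` times the value at the cusp `0`.
No condition is imposed on `g` at `∞`. -/
lemma intervalIntegral_eq_of_weight_two (hol : MDiff g)
    (hg : ∀ γ ∈ Gamma0 p, g ∣[(2 : ℤ)] γ = g) {b : ℂ}
    (hb : Tendsto (g ∣[(2 : ℤ)] ModularGroup.S) atImInfty (𝓝 b)) :
    ∫ x in (0 : ℝ)..1, (g ∘ ofComplex) (x + (1 : ℝ) * Complex.I) = -(p * b) := by
  set t := cosetSum p 2 g with ht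
  have htm : MDiff t := by
    rw [ht, cosetSum]
    refine Finset.sum_induction _ (fun F : ℍ → ℂ ↦ MDiff F) (fun _ _ h h' ↦ h.add h') ?_ ?_
    · exact mdifferentiable_const
    · exact fun x _ ↦ mdifferentiable_slash hol 2 _
  have hT_of {F : ℍ → ℂ} (hF : F ∣[(2 : ℤ)] ModularGroup.T = F) (z : ℍ) :
      F ((1 : ℝ) +ᵥ z) = F z := by
    conv_rhs => rw [← hF]
    simpa using (slash_T_zpow_apply (k := 2) F 1 z).symm
  have htT := hT_of (cosetSum_slash_T hg)
  have hgT : g ∣[(2 : ℤ)] ModularGroup.T = g :=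
    hg _ (mem_Gamma0_iff_dvd.mpr (by simp [ModularGroup.T]))
  have h0 := intervalIntegral_eq_zero_of_weight_two (hol.add htm)
    (add_cosetSum_slash_S hg) (hT_of (by rw [SlashAction.add_slash, hgT, cosetSum_slash_T hg]))
    one_pos
  have htl := tendsto_cosetSum (p := p) hb
  have htper := periodic_comp_ofComplex_of_vadd htT
  have h1 := UpperHalfPlane.qExpansion_coeff_eq_intervalIntegral one_pos htper htm
    (isBoundedAtImInfty_of_tendsto htl) 0 one_pos
  have h2 : (qExpansion 1 t).coeff 0 = p * b := by
    rw [qExpansion_coeff]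
    simpa using tendsto_nhds_unique (tendsto_cuspFunction_zero one_pos htper htm
      (isBoundedAtImInfty_of_tendsto htl)) htl
  have him (x : ℝ) : 0 < (x + (1 : ℝ) * Complex.I : ℂ).im := by simp
  have hcont {F : ℍ → ℂ} (hF : MDiff F) :
      Continuous fun x : ℝ ↦ (F ∘ ofComplex) (x + (1 : ℝ) * Complex.I) :=
    (UpperHalfPlane.mdifferentiable_iff.mp hF).continuousOn.comp_continuous (by fun_prop) him
  have h3 : ∫ x in (0 : ℝ)..1, (t ∘ ofComplex) (x + (1 : ℝ) * Complex.I) = p * b := by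
    rw [← h2, h1]
    simp only [Complex.ofReal_one, div_one, one_mul, pow_zero]
    refine intervalIntegral.integral_congr fun x _ ↦ ?_
    have := him x
    rw [Complex.ofReal_one, one_mul] at this
    simp only [Function.comp_apply, ofComplex_apply_of_im_pos this]
    simp [ht]
  have h4 := intervalIntegral.integral_add (μ := MeasureTheory.volume)
    ((hcont hol).intervalIntegrable 0 1) ((hcont htm).intervalIntegrable 0 1)
  rw [h3] at h4
  linear_combination h4.symm.trans h0

end Trace

/-! ### A modular unit with integral expansion -/

section ModularUnit

variable {f g : ℍ → ℂ} {P Q : PowerSeries ℤ}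

lemma mdifferentiable_div (hf : MDiff f) (hg : MDiff g) (hg0 : ∀ z, g z ≠ 0) : MDiff (f / g) := by
  rw [UpperHalfPlane.mdifferentiable_iff]
  exact (UpperHalfPlane.mdifferentiable_iff.mp hf).div
    (UpperHalfPlane.mdifferentiable_iff.mp hg) fun z _ ↦ hg0 _

lemma mdifferentiable_comp_mulMatrix (p : ℕ) [Fact p.Prime] (hf : MDiff f) :
    MDiff (fun z ↦ f (mulMatrix p • z)) := by
  have h : MDiff (f ∣[(1 : ℤ)] mulMatrix p) := hf.slash 1 (mulMatrix p)
  convert! h using 1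
  ext z
  simp [slash_mulMatrix_apply]

/-- `f` is a holomorphic function on the upper half plane that is the sum of the power series `P`
in `q = exp (2 π i z)`; no modularity is required. -/
def HasIntegralExpansion (f : ℍ → ℂ) (P : PowerSeries ℤ) : Prop :=
  MDiff f ∧ ∀ z : ℍ,
    HasSum (fun m ↦ coeff m (PowerSeries.map (Int.castRingHom ℂ) P) * 𝕢 1 z ^ m) (f z)

lemma HasIntegralExpansion.qExpansion_eq (h : HasIntegralExpansion f P) :
    qExpansion 1 f = PowerSeries.map (Int.castRingHom ℂ) P :=
  qExpansion_eq_of_hasSum h.1 h.2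

lemma HasIntegralExpansion.analyticAt (h : HasIntegralExpansion f P) :
    AnalyticAt ℂ (cuspFunction 1 f) 0 :=
  analyticAt_cuspFunction_of_hasSum h.1 h.2

lemma HasIntegralExpansion.vadd (h : HasIntegralExpansion f P) (z : ℍ) :
    f ((1 : ℝ) +ᵥ z) = f z :=
  vadd_eq_of_hasSum h.2 z

lemma HasIntegralExpansion.tendsto (h : HasIntegralExpansion f P) :
    Tendsto f atImInfty (𝓝 (constantCoeff P : ℤ)) := by
  have h1 := tendsto_of_hasSum h.1 h.2
  rw [← coeff_zero_eq_constantCoeff_apply, PowerSeries.coeff_map] at h1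
  simpa using h1

lemma HasIntegralExpansion.isBoundedAtImInfty (h : HasIntegralExpansion f P) :
    IsBoundedAtImInfty f :=
  isBoundedAtImInfty_of_tendsto h.tendsto

lemma hasIntegralExpansion_of_qExpansion_eq (hf : MDiff f) (hT : ∀ z : ℍ, f ((1 : ℝ) +ᵥ z) = f z)
    (hb : IsBoundedAtImInfty f) (h : qExpansion 1 f = PowerSeries.map (Int.castRingHom ℂ) P) :
    HasIntegralExpansion f P := by
  refine ⟨hf, fun z ↦ ?_⟩
  rw [← h]
  exact UpperHalfPlane.hasSum_qExpansion one_pos (periodic_comp_ofComplex_of_vadd hT) hf hb z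

lemma HasIntegralExpansion.mul (hf : HasIntegralExpansion f P) (hg : HasIntegralExpansion g Q) :
    HasIntegralExpansion (f * g) (P * Q) := by
  refine hasIntegralExpansion_of_qExpansion_eq (hf.1.mul hg.1)
    (fun z ↦ by rw [Pi.mul_apply, hf.vadd, hg.vadd, Pi.mul_apply])
    (isBoundedAtImInfty_of_tendsto (hf.tendsto.mul hg.tendsto)) ?_
  rw [UpperHalfPlane.qExpansion_mul hf.analyticAt hg.analyticAt, hf.qExpansion_eq,
    hg.qExpansion_eq, map_mul]

lemma hasIntegralExpansion_one : HasIntegralExpansion 1 1 := by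
  refine hasIntegralExpansion_of_qExpansion_eq mdifferentiable_const (fun z ↦ rfl)
    (isBoundedAtImInfty_of_tendsto tendsto_const_nhds) ?_
  rw [map_one]
  exact UpperHalfPlane.qExpansion_one 1

lemma HasIntegralExpansion.pow (hf : HasIntegralExpansion f P) (n : ℕ) :
    HasIntegralExpansion (f ^ n) (P ^ n) := by
  induction n with
  | zero => simpa using hasIntegralExpansion_one
  | succ n ih => simpa only [pow_succ] using ih.mul hf

lemma HasIntegralExpansion.div (hf : HasIntegralExpansion f P) (hg : HasIntegralExpansion g Q)
    (hg0 : ∀ z, g z ≠ 0) (hQ : constantCoeff Q = 1) :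
    HasIntegralExpansion (f / g) (P * invOfUnit Q 1) := by
  have hol : MDiff (f / g) := mdifferentiable_div hf.1 hg.1 hg0
  have hT (z : ℍ) : (f / g) ((1 : ℝ) +ᵥ z) = (f / g) z := by
    rw [Pi.div_apply, hf.vadd, hg.vadd, Pi.div_apply]
  have hb : IsBoundedAtImInfty (f / g) :=
    isBoundedAtImInfty_of_tendsto (hf.tendsto.div hg.tendsto (by simp [hQ]))
  refine hasIntegralExpansion_of_qExpansion_eq hol hT hb ?_
  have han := analyticAt_cuspFunction_zero one_pos (periodic_comp_ofComplex_of_vadd hT) hol hb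
  have h1 : qExpansion 1 (f / g) * qExpansion 1 g = qExpansion 1 f := by
    rw [← UpperHalfPlane.qExpansion_mul han hg.analyticAt]
    congr 1
    ext z
    exact div_mul_cancel₀ _ (hg0 z)
  have h2 : PowerSeries.map (Int.castRingHom ℂ) Q *
      PowerSeries.map (Int.castRingHom ℂ) (invOfUnit Q 1) = 1 := by
    rw [← map_mul, mul_invOfUnit Q 1 (by simpa using hQ), map_one]
  rw [map_mul, ← hf.qExpansion_eq, ← h1, mul_assoc, hg.qExpansion_eq, h2, mul_one]

lemma HasIntegralExpansion.comp_mulMatrix (p : ℕ) [Fact p.Prime] (hf : HasIntegralExpansion f P) :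
    HasIntegralExpansion (fun z ↦ f (mulMatrix p • z)) (P.expand p (prime_ne_zero p)) := by
  refine ⟨mdifferentiable_comp_mulMatrix p hf.1, fun z ↦ ?_⟩
  have h := hf.2 (mulMatrix p • z)
  rw [qParam_mulMatrix_smul] at h
  rw [PowerSeries.map_expand]
  exact hasSum_expand p h

lemma qParam_ne_zero (z : ℂ) : 𝕢 1 z ≠ 0 := Complex.exp_ne_zero _

/-- The quotient `Δ / q`. -/
def reducedDiscriminant : ℍ → ℂ := fun z ↦ discriminant z / 𝕢 1 z

lemma reducedDiscriminant_ne_zero (z : ℍ) : reducedDiscriminant z ≠ 0 :=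
  div_ne_zero (discriminant_ne_zero z) (qParam_ne_zero z)

lemma exists_hasIntegralExpansion_reducedDiscriminant :
    ∃ P, HasIntegralExpansion reducedDiscriminant P ∧ constantCoeff P = 1 := by
  obtain ⟨P, hP, hP1⟩ := exists_qExpansion_discriminant
  refine ⟨P, ⟨?_, fun z ↦ ?_⟩, hP1⟩
  · rw [UpperHalfPlane.mdifferentiable_iff]
    have h : DifferentiableOn ℂ (fun z ↦ (CuspForm.discriminant ∘ ofComplex) z / 𝕢 1 z)
        {z | 0 < z.im} :=
      (UpperHalfPlane.mdifferentiable_iff.mp CuspForm.discriminant.holo').div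
        (Function.Periodic.differentiable_qParam).differentiableOn fun z _ ↦ qParam_ne_zero z
    refine h.congr fun z hz ↦ ?_
    simp only [Function.comp_apply, reducedDiscriminant, ofComplex_apply_of_im_pos hz]
    rfl
  · have h := ModularForm.hasSum_qExpansion CuspForm.discriminant one_pos
      one_mem_strictPeriods_SL z
    have h0 : ∑ i ∈ Finset.range 1, coeff i (PowerSeries.map (Int.castRingHom ℂ) (X * P)) *
        𝕢 1 (z : ℂ) ^ i = 0 := by simp
    rw [hP, ← hasSum_nat_add_iff' 1, h0, sub_zero] at h
    refine hasSum_of_forall_eq (h.div_const (𝕢 1 (z : ℂ))) fun m ↦ ?_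
    rw [PowerSeries.coeff_map, PowerSeries.coeff_map, coeff_succ_X_mul, pow_succ]
    have := qParam_ne_zero z
    field_simp

variable (p : ℕ) [Fact p.Prime]

/-- The modular unit `Δ(z) / Δ(p z) ^ p`, holomorphic on the upper half plane, of weight
`12 - 12 p` for `Γ₀(p)`, nonzero at the cusp `0` and with a pole at `∞`. -/
def modularUnit : ℍ → ℂ := fun z ↦ discriminant z / discriminant (mulMatrix p • z) ^ p

lemma slash_pow_SL2 {k : ℤ} (γ : SL(2, ℤ)) (f : ℍ → ℂ) (n : ℕ) :
    (f ^ n) ∣[n * k] γ = (f ∣[k] γ) ^ n := by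
  ext z
  rw [Pi.pow_apply, SL_slash_apply, SL_slash_apply, mul_pow, ← zpow_natCast (_ ^ (-k)), ← zpow_mul,
    Pi.pow_apply]
  congr 2
  ring

lemma slash_discriminant (γ : SL(2, ℤ)) : discriminant ∣[(12 : ℤ)] γ = discriminant :=
  slash_levelOne (CuspForm.discriminant : ModularForm 𝒮ℒ 12) γ

lemma modularUnit_eq : modularUnit p =
    (p : ℂ) ^ (11 * p) • (discriminant / (discriminant ∣[(12 : ℤ)] mulMatrix p) ^ p) := by
  have hp : (p : ℂ) ≠ 0 := by exact_mod_cast prime_ne_zero p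
  ext z
  rw [Pi.smul_apply, Pi.div_apply, Pi.pow_apply, slash_mulMatrix_apply, modularUnit, smul_eq_mul]
  norm_num
  rw [mul_pow, ← pow_mul]
  have : discriminant (mulMatrix p • z) ≠ 0 := discriminant_ne_zero _
  field_simp

lemma mdifferentiable_modularUnit : MDiff (modularUnit p) := by
  have h : MDiff discriminant := CuspForm.discriminant.holo'
  exact mdifferentiable_div (g := (fun z ↦ discriminant (mulMatrix p • z)) ^ p) h
    ((mdifferentiable_comp_mulMatrix p h).pow p) fun z ↦ pow_ne_zero _ (discriminant_ne_zero _)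

lemma modularUnit_slash (γ : SL(2, ℤ)) : modularUnit p ∣[(12 - p * 12 : ℤ)] γ =
    (p : ℂ) ^ (11 * p) •
      (discriminant / ((discriminant ∣[(12 : ℤ)] mulMatrix p) ∣[(12 : ℤ)] γ) ^ p) := by
  rw [modularUnit_eq, SL_smul_slash, div_slash_SL2, slash_pow_SL2, slash_discriminant]

lemma modularUnit_slash_of_mem {γ : SL(2, ℤ)} (hγ : γ ∈ Gamma0 p) :
    modularUnit p ∣[(12 - p * 12 : ℤ)] γ = modularUnit p := by
  rw [modularUnit_slash, slash_mulMatrix_of_levelOne p slash_discriminant hγ, ← modularUnit_eq]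

lemma qParam_divMatrix_smul (z : ℍ) : 𝕢 1 ((divMatrix p • z : ℍ) : ℂ) ^ p = 𝕢 1 (z : ℂ) := by
  have hp : (p : ℂ) ≠ 0 := by exact_mod_cast prime_ne_zero p
  rw [← qParam_mulMatrix_smul, coe_mulMatrix_smul,
    coe_smul_of_det_pos (by rw [det_divMatrix]; exact cast_prime_pos p)]
  congr 1
  simp [num, denom, divMatrix, Matrix.GeneralLinearGroup.mkOfDetNeZero]
  field_simp

lemma tendsto_modularUnit_slash_S :
    Tendsto (modularUnit p ∣[(12 - p * 12 : ℤ)] ModularGroup.S) atImInfty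
      (𝓝 ((p : ℂ) ^ (12 * p))) := by
  have hp : (p : ℂ) ≠ 0 := by exact_mod_cast prime_ne_zero p
  obtain ⟨P, hP, hP1⟩ := exists_hasIntegralExpansion_reducedDiscriminant
  have h := hP.tendsto
  rw [hP1, Int.cast_one] at h
  have h1 := (h.div ((h.comp (tendsto_divMatrix_smul p)).pow p) (by simp)).const_mul
    ((p : ℂ) ^ (12 * p))
  rw [one_pow, div_one, mul_one] at h1
  refine h1.congr fun z ↦ ?_
  rw [modularUnit_slash, slash_mulMatrix_slash_S, slash_discriminant, Pi.smul_apply, Pi.div_apply,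
    Pi.div_apply, Pi.pow_apply, slash_divMatrix_apply, Function.comp_apply, reducedDiscriminant,
    reducedDiscriminant, smul_eq_mul, mul_pow, div_pow, qParam_divMatrix_smul, inv_pow]
  have := qParam_ne_zero z
  have : discriminant (divMatrix p • z) ≠ 0 := discriminant_ne_zero _
  field_simp
  ring

lemma exists_hasIntegralExpansion_modularUnit :
    ∃ P, HasIntegralExpansion (fun z ↦ 𝕢 1 z ^ (p ^ 2 - 1) * modularUnit p z) P := by
  obtain ⟨P, hP, hP1⟩ := exists_hasIntegralExpansion_reducedDiscriminant
  have h := hP.div ((hP.comp_mulMatrix p).pow p)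
    (fun z ↦ pow_ne_zero _ (reducedDiscriminant_ne_zero _)) (by
      rw [map_pow, constantCoeff_expand, hP1, one_pow])
  refine ⟨P * invOfUnit (P.expand p (prime_ne_zero p) ^ p) 1, ?_⟩
  convert h using 1
  ext z
  rw [Pi.div_apply, Pi.pow_apply, reducedDiscriminant, reducedDiscriminant, modularUnit,
    qParam_mulMatrix_smul, div_pow, ← pow_mul, ← sq]
  have := qParam_ne_zero z
  have : discriminant (mulMatrix p • z) ≠ 0 := discriminant_ne_zero _
  obtain ⟨n, hn⟩ := Nat.exists_eq_succ_of_ne_zero (pow_ne_zero 2 (prime_ne_zero p))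
  rw [hn, Nat.succ_sub_one, pow_succ]
  field_simp

end ModularUnit

/-! ### Integrality of the value at the cusp `0` -/

section Integrality

variable {p : ℕ} [Fact p.Prime] {k : ℤ} {P : PowerSeries ℤ} {b : ℂ}

/-- The residue theorem for the product of `F` and the power of `modularUnit p` that has weight
two. The residue at `∞` is a coefficient of a power series with integer coefficients. -/
lemma IsIntegralForm.exists_int_of_weight (h : IsIntegralForm p k P b) (a : ℕ)
    (hk : k + a * (12 - p * 12) = 2) : ∃ n : ℤ, (p : ℂ) ^ (12 * p * a + 1) * b = n := by
  obtain ⟨F, hF, hb⟩ := h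
  obtain ⟨U, hU⟩ := exists_hasIntegralExpansion_modularUnit p
  set u := modularUnit p with hu
  set g : ℍ → ℂ := F * u ^ a with hg
  have hgm : MDiff g := F.holo'.mul ((mdifferentiable_modularUnit p).pow a)
  have hslash (γ : SL(2, ℤ)) : g ∣[(2 : ℤ)] γ =
      (F : ℍ → ℂ) ∣[k] γ * (u ∣[(12 - p * 12 : ℤ)] γ) ^ a := by
    rw [← hk, hg, mul_slash_SL2, slash_pow_SL2]
  have hinv : ∀ γ ∈ Gamma0 p, g ∣[(2 : ℤ)] γ = g := fun γ hγ ↦ by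
    rw [hslash, slash_eq_of_mem_Gamma0 F hγ, modularUnit_slash_of_mem p hγ]
  have hlim : Tendsto (g ∣[(2 : ℤ)] ModularGroup.S) atImInfty
      (𝓝 (b * ((p : ℂ) ^ (12 * p)) ^ a)) := by
    rw [hslash]
    exact hb.mul ((tendsto_modularUnit_slash_S p).pow a)
  have hFe : HasIntegralExpansion F P :=
    ⟨F.holo', fun z ↦ hF ▸ ModularForm.hasSum_qExpansion F one_pos one_mem_strictPeriods z⟩
  have hw := hFe.mul (hU.pow a)
  set N := (p ^ 2 - 1) * a
  have h1 := intervalIntegral_eq_of_weight_two hgm hinv hlim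
  have h2 := UpperHalfPlane.qExpansion_coeff_eq_intervalIntegral one_pos
    (periodic_comp_ofComplex_of_vadd hw.vadd) hw.1 hw.isBoundedAtImInfty N one_pos
  refine ⟨-coeff N (P * U ^ a), ?_⟩
  rw [hw.qExpansion_eq, PowerSeries.coeff_map, eq_intCast] at h2
  rw [Int.cast_neg, h2, ← neg_eq_iff_eq_neg]
  have h3 : -((p : ℂ) ^ (12 * p * a + 1) * b) = -(p * (b * ((p : ℂ) ^ (12 * p)) ^ a)) := by
    rw [pow_succ, pow_mul]
    ring
  rw [h3, ← h1]
  simp only [Complex.ofReal_one, div_one, one_mul]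
  refine intervalIntegral.integral_congr fun x _ ↦ ?_
  have him : 0 < (x + Complex.I : ℂ).im := by simp
  have hq := qParam_ne_zero (x + Complex.I)
  simp only [Function.comp_apply, ofComplex_apply_of_im_pos him, Pi.mul_apply, Pi.pow_apply, hg,
    mul_pow, ← pow_mul]
  field_simp
  simp only [N, UpperHalfPlane.coe_I]
  ring

/-- The value at `0` of a form with integral expansion has bounded denominator. Multiply the form
by `E(p z)`, where `E` has level one and constant term `1`, and by a power of `modularUnit p`, to
bring it to weight two, and apply the residue theorem. -/
lemma IsIntegralForm.exists_int_mul (h : IsIntegralForm p k P b) (a w : ℕ) (hw : 4 ≤ w)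
    (hw2 : Even w) (hk : k + w = 2 + 12 * a * (p - 1)) :
    ∃ n : ℤ, (p : ℂ) ^ (12 * a + k - 1 : ℤ) * b = n := by
  obtain ⟨E, hE, hE1⟩ := exists_isLevelOneForm hw hw2
  obtain ⟨n, hn⟩ := (h.mul (hE.isIntegralForm_expand p)).exists_int_of_weight a
    (by rw [hk]; ring)
  have hp : (p : ℂ) ≠ 0 := by exact_mod_cast prime_ne_zero p
  refine ⟨n, ?_⟩
  rw [← hn, hE1, ← zpow_natCast]
  have h1 : (12 * a + k - 1 : ℤ) = ((12 * p * a + 1 : ℕ) : ℤ) + -w := by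
    push_cast
    linear_combination hk
  rw [h1, zpow_add₀ hp]
  push_cast
  ring

/-- An element `c` of `ℤ[1/p]` is an integer if `c ^ (m + 1)` has denominator at most `p ^ m`. -/
lemma exists_int_eq_of_pow {c : ℂ} {e m : ℕ} (n N : ℤ) (h1 : (p : ℂ) ^ e * c = n)
    (h2 : (p : ℂ) ^ m * c ^ (m + 1) = N) : ∃ n₀ : ℤ, c = n₀ := by
  have hp : (p : ℂ) ≠ 0 := by exact_mod_cast prime_ne_zero p
  induction e generalizing n with
  | zero => exact ⟨n, by simpa using h1⟩
  | succ e ih =>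
    have h3 : n ^ (m + 1) = p * (p ^ (e * (m + 1)) * N) := by
      have : (n : ℂ) ^ (m + 1) = p * (p ^ (e * (m + 1)) * N) := by
        rw [← h1, ← h2, mul_pow, ← pow_mul, add_mul, one_mul, pow_add, pow_succ _ m]
        ring
      exact_mod_cast this
    obtain ⟨n₁, rfl⟩ := (Nat.prime_iff_prime_int.mp Fact.out).dvd_of_dvd_pow (Dvd.intro _ h3.symm)
    refine ih n₁ (mul_left_cancel₀ hp ?_)
    rw [← mul_assoc, ← pow_succ', h1]
    push_cast
    rfl

/-- The value `b` at `0` of a form of even weight `k` with integral expansion satisfies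
`v_p(b) ≥ -(k + ⌊k / (p - 1)⌋)`, and no other prime divides its denominator. The bound for
`b` obtained from `exists_int_mul` is lossy, and is applied to the power `b ^ (12 (p - 1))`. -/
lemma IsIntegralForm.exists_int_mul_value {k : ℕ} (h : IsIntegralForm p k P b) (hp : 3 < p)
    (hk0 : 0 < k) (hk : Even k) : ∃ n : ℤ, (p : ℂ) ^ (k + k / (p - 1)) * b = n := by
  have hpc : (p : ℂ) ≠ 0 := by exact_mod_cast prime_ne_zero p
  obtain ⟨q, rfl⟩ : ∃ q, p = q + 1 := ⟨p - 1, by omega⟩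
  rw [Nat.add_sub_cancel]
  set i := k / q with hi
  have hq : 3 ≤ q := by omega
  have hq2 : Even q := by
    have h2 : Odd (q + 1) := (Fact.out : (q + 1).Prime).odd_of_ne_two (by omega)
    simpa [Nat.odd_add_one] using h2
  have hkq : k * 3 ≤ k * q := Nat.mul_le_mul_left k hq
  -- `b` lies in `ℤ[1/p]`
  have hle : k + 4 ≤ 2 + 12 * k * q := by nlinarith
  obtain ⟨n, hn⟩ := h.exists_int_mul k (2 + 12 * k * q - k) (by omega) (by
      rw [Nat.even_sub (by omega)]
      simp [Nat.even_add, hk, mul_assoc]) (by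
      rw [Nat.cast_sub (by omega)]
      push_cast
      ring)
  -- the exponent `12 q` is chosen so that the auxiliary weight `2 + 12 q` does not depend on `k`;
  -- the excess `12 (k + 1) - 1` in the exponent is less than `12 q (i + 1)`
  obtain ⟨N, hN⟩ := (h.pow (12 * q)).exists_int_mul (k + 1) (2 + 12 * q) (by omega)
    (by simp [Nat.even_add, hq2]) (by push_cast; ring)
  have hik : k = q * i + k % q := (Nat.div_add_mod k q).symm
  have hmod : k % q < q := Nat.mod_lt _ (by omega)
  obtain ⟨m, hm⟩ : ∃ m, 12 * q = m + 1 := ⟨12 * q - 1, by omega⟩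
  refine exists_int_eq_of_pow (p := q + 1) (e := 13 * k) (m := m)
    ((q + 1 : ℕ) ^ (k + i + 1) * n) ((q + 1 : ℕ) ^ (m - (12 * (k % q) + 11)) * N) ?_ ?_
  · have h1 : (12 * k + k - 1 : ℤ) = ((13 * k - 1 : ℕ) : ℤ) := by omega
    rw [h1, zpow_natCast] at hn
    push_cast at hn ⊢
    rw [← hn, ← mul_assoc, ← mul_assoc, ← pow_add, ← pow_add]
    congr 2
    omega
  · have h1 : (12 * (k + 1 : ℕ) + (12 * q : ℕ) * k - 1 : ℤ) =
        ((12 * k + 11 + 12 * (q * k) : ℕ) : ℤ) := by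
      push_cast
      ring
    rw [h1, zpow_natCast] at hN
    have h2 : m + (k + i) * (m + 1) =
        m - (12 * (k % q) + 11) + (12 * k + 11 + 12 * (q * k)) := by
      have h3 : (k + i) * (m + 1) = 12 * (q * k) + 12 * (q * i) := by rw [← hm]; ring
      omega
    rw [mul_pow, ← pow_mul, ← mul_assoc, ← pow_add, h2, pow_add, mul_assoc, ← hm, hN]
    push_cast
    rfl

end Integrality

/-! ### Congruences with forms vanishing at both cusps -/

section Congruence

variable {p : ℕ} [Fact p.Prime] {k : ℤ} {P : PowerSeries ℤ} {b : ℂ}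

omit [Fact p.Prime] in
lemma IsIntegralForm.of_smul {n : ℤ} (hn : n ≠ 0) (h : IsIntegralForm p k (n • P) (n * b)) :
    IsIntegralForm p k P b := by
  have hn' : (n : ℂ) ≠ 0 := by exact_mod_cast hn
  obtain ⟨F, hF, hb⟩ := h
  refine ⟨(n : ℂ)⁻¹ • F, ?_, ?_⟩
  · rw [FunLike.coe_smul, ModularForm.qExpansion_smul one_pos one_mem_strictPeriods, hF,
      map_zsmul, ← Int.cast_smul_eq_zsmul ℂ, smul_smul, inv_mul_cancel₀ hn', one_smul]
  · rw [FunLike.coe_smul, ModularForm.SL_smul_slash]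
    have h := hb.const_smul (n : ℂ)⁻¹
    rwa [smul_eq_mul, ← mul_assoc, inv_mul_cancel₀ hn', one_mul] at h

lemma not_dvd_mul {m n : ℤ} (hm : ¬ (p : ℤ) ∣ m) (hn : ¬ (p : ℤ) ∣ n) : ¬ (p : ℤ) ∣ m * n :=
  (Nat.prime_iff_prime_int.mp Fact.out).not_dvd_mul hm hn

lemma not_dvd_twelve (hp : 3 < p) : ¬ (p : ℤ) ∣ 12 := by
  have h2 : ¬ (p : ℤ) ∣ 2 := fun h ↦ by have := Int.le_of_dvd two_pos h; omega
  have h3 : ¬ (p : ℤ) ∣ 3 := fun h ↦ by have := Int.le_of_dvd three_pos h; omega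
  exact not_dvd_mul (m := 2 * 2) (not_dvd_mul h2 h2) h3

lemma not_dvd_one_sub_pow {n : ℕ} (hn : n ≠ 0) : ¬ (p : ℤ) ∣ 1 - p ^ n := by
  have hp := Nat.prime_iff_prime_int.mp (Fact.out : p.Prime)
  rw [dvd_sub_left (dvd_pow_self _ hn)]
  exact hp.not_dvd_one

/-- The form `(E(p z) - E(z)) / p`, where `E = v + O(p)` is the multiple of the Eisenstein series
of weight `p - 1` with constant term prime to `p`. It has weight `p - 1`, and its value at `0` has
denominator `p ^ p`. -/
lemma exists_isIntegralForm_hasse (hp : 3 < p) :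
    ∃ (u : ℤ) (Q : PowerSeries ℤ), ¬ (p : ℤ) ∣ u ∧
      IsIntegralForm p ((p - 1 : ℕ) : ℤ) Q (u / p ^ p) := by
  have hpc : (p : ℂ) ≠ 0 := by exact_mod_cast prime_ne_zero p
  obtain ⟨v, Q, hv, hQ, h⟩ := exists_isLevelOneForm_hasse p hp
  have h1 := (h.isIntegralForm_expand p).add ((h.isIntegralForm p).smul (-1))
  refine ⟨v * (1 - p ^ (p - 1)), Q.expand p (prime_ne_zero p) - Q,
    not_dvd_mul hv (not_dvd_one_sub_pow (by omega)), ?_⟩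
  have hw : ((p - 1 : ℕ) : ℤ) = p - 1 := by omega
  rw [hw]
  refine IsIntegralForm.of_smul (n := p) (by exact_mod_cast prime_ne_zero p) ?_
  convert h1 using 1
  · rw [map_add, map_zsmul, expand_C]
    module
  · have h2 : (p : ℂ) ^ p = p ^ (p - 1) * p := by
      rw [← pow_succ, Nat.sub_add_cancel (by omega)]
    rw [← hw, zpow_neg, zpow_natCast, h2]
    simp [hQ]
    field_simp
    ring

/-- The product of `E(p z)`, where `E` has level one and weight `w`, with the `n`-th power of the
form of `exists_isIntegralForm_hasse`, has a pole of order `w + n p` at `0`. -/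
lemma exists_isIntegralForm_pole (hp : 3 < p) {w n : ℕ} (hw : 4 ≤ w) (hw2 : Even w) :
    ∃ (u : ℤ) (Q : PowerSeries ℤ), ¬ (p : ℤ) ∣ u ∧
      IsIntegralForm p ((w + n * (p - 1) : ℕ) : ℤ) Q (u / p ^ (w + n * p)) := by
  have hpc : (p : ℂ) ≠ 0 := by exact_mod_cast prime_ne_zero p
  obtain ⟨u, Q, hu, h⟩ := exists_isIntegralForm_hasse hp
  obtain ⟨E, hE, hE1⟩ := exists_isLevelOneForm hw hw2
  refine ⟨u ^ n, E.expand p (prime_ne_zero p) * Q ^ n,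
    fun hd ↦ hu ((Nat.prime_iff_prime_int.mp Fact.out).dvd_of_dvd_pow hd), ?_⟩
  have h1 := ((hE.isIntegralForm_expand p).mul (h.pow n)).cast
    (l := ((w + n * (p - 1) : ℕ) : ℤ)) (by push_cast; ring)
  convert! h1 using 1
  rw [hE1, zpow_neg, zpow_natCast, div_pow, ← pow_mul, pow_add, mul_comm p n]
  push_cast
  field_simp

/-- If a form has value `0` at the cusp `0` and constant term divisible by `p` at `∞`, then a
multiple of it by an integer prime to `p` is congruent to a cusp form modulo `p`. -/
lemma IsIntegralForm.exists_mem_integralCuspForms {w : ℕ} (hw : 4 ≤ w) (hw2 : Even w)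
    (h : IsIntegralForm p w P 0) (hP : (p : ℤ) ∣ constantCoeff P) :
    ∃ (n : ℤ) (Q : PowerSeries ℤ), ¬ (p : ℤ) ∣ n ∧
      n • P + (p : ℤ) • Q ∈ integralCuspForms p w := by
  have hpc : (p : ℂ) ≠ 0 := by exact_mod_cast prime_ne_zero p
  obtain ⟨c, hc⟩ := hP
  obtain ⟨E, hE, hE1⟩ := exists_isLevelOneForm hw hw2
  have h1 := (hE.isIntegralForm p).add ((hE.isIntegralForm_expand p).smul (-p ^ w))
  have h2 := (h.smul (1 - p ^ w)).add (h1.smul (-(p * c)))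
  refine ⟨1 - p ^ w, -c • (E + (-(p : ℤ) ^ w) • E.expand p (prime_ne_zero p)),
    not_dvd_one_sub_pow (by omega), ?_⟩
  have h3 : ((1 - p ^ w : ℤ) : ℂ) * 0 + ((-(p * c) : ℤ) : ℂ) * ((constantCoeff E : ℤ) +
      ((-(p : ℤ) ^ w : ℤ) : ℂ) * ((p : ℂ) ^ (-(w : ℤ)) * (constantCoeff E : ℤ))) = 0 := by
    rw [hE1, zpow_neg, zpow_natCast]
    push_cast
    field_simp
    ring
  rw [h3] at h2
  rw [smul_smul, mul_neg]
  refine h2.mem_integralCuspForms ?_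
  simp [hc, hE1, constantCoeff_expand]
  ring

/-- Under the condition on the weight, `θ F` is congruent modulo `p` to a cusp form, up to a factor
prime to `p`. -/
lemma exists_theta_mem_integralCuspForms (hp : 3 < p) {k : ℕ} (hk0 : 0 < k) (hk2 : Even k)
    (hk : ¬ (p - 1) ∣ k ∨ p ∣ k) (hP : P ∈ integralForms p k) :
    ∃ (n : ℤ) (Q : PowerSeries ℤ), ¬ (p : ℤ) ∣ n ∧
      n • (X * PowerSeries.derivative ℤ P) + (p : ℤ) • Q ∈ integralCuspForms p (k + 2) := by
  have hpc : (p : ℂ) ≠ 0 := by exact_mod_cast prime_ne_zero p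
  obtain ⟨b, hb⟩ := exists_isIntegralForm hP
  obtain ⟨β, hβ⟩ := hb.exists_int_mul_value hp hk0 hk2
  obtain ⟨Q, hQ⟩ := hb.theta
  obtain ⟨q, rfl⟩ : ∃ q, p = q + 1 := ⟨p - 1, by omega⟩
  have hq2 : Even q := by
    have h2 : Odd (q + 1) := (Fact.out : (q + 1).Prime).odd_of_ne_two (by omega)
    simpa [Nat.odd_add_one] using h2
  rw [Nat.add_sub_cancel] at hk hβ
  set i := k / q with hi
  obtain ⟨r, hr⟩ : ∃ r, r = k % q := ⟨_, rfl⟩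
  have hik : k = q * i + r := hr ▸ (Nat.div_add_mod k q).symm
  clear_value i
  have hr2 : Even r := by
    rw [hik, Nat.even_add] at hk2
    exact hk2.mp (hq2.mul_right i)
  -- the value at `0` of the form `G` of `IsIntegralForm.theta` has denominator at most `p ^ s`, and
  -- `p R` attains this bound
  obtain ⟨u, R, s, y, hu, hR, hy⟩ : ∃ (u : ℤ) (R : PowerSeries ℤ) (s : ℕ) (y : ℤ),
      ¬ ((q + 1 : ℕ) : ℤ) ∣ u ∧ IsIntegralForm (q + 1) (k + 2) R (u / (q + 1 : ℕ) ^ (s + 1)) ∧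
      ((q + 1 : ℕ) : ℂ) ^ s * (-(k : ℤ) * b / (q + 1 : ℕ)) = y := by
    by_cases hr0 : r = 0
    · obtain ⟨l, hl⟩ := hk.resolve_left (not_not.mpr (Nat.dvd_of_mod_eq_zero (hr ▸ hr0)))
      obtain ⟨j, hj⟩ : ∃ j, i = j + 1 := ⟨i - 1, by
        rcases Nat.eq_zero_or_pos i with h0 | h0
        · rw [h0, hr0] at hik
          omega
        · omega⟩
      have hkj : k = q * j + q := by rw [hik, hj, hr0]; ring
      obtain ⟨u, R, hu, hR⟩ := exists_isIntegralForm_pole (p := q + 1) hp (w := q + 2) (n := j)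
        (by omega) (by simp [Nat.even_add, hq2])
      refine ⟨u, R, k + i, -l * β, hu, ?_, ?_⟩
      · convert! hR.cast (l := k + 2) ?_ using 3
        · rw [hj, hkj]
          ring
        · rw [Nat.add_sub_cancel, hkj]
          push_cast
          ring
      · push_cast at hβ hl hpc ⊢
        have hlc : (k : ℂ) = (q + 1) * l := by exact_mod_cast hl
        rw [← hβ, hlc]
        field_simp
    · obtain ⟨u, R, hu, hR⟩ := exists_isIntegralForm_pole (p := q + 1) hp (w := r + 2) (n := i)
        (by obtain ⟨m, hm⟩ := hr2; omega) (by simp [Nat.even_add, hr2])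
      refine ⟨u, R, k + i + 1, -k * β, hu, ?_, ?_⟩
      · convert! hR.cast (l := k + 2) ?_ using 3
        · rw [hik]
          ring
        · rw [Nat.add_sub_cancel, hik]
          push_cast
          ring
      · push_cast at hβ hpc ⊢
        rw [← hβ, pow_succ]
        field_simp
  set G := (12 : ℤ) • (X * PowerSeries.derivative ℤ P) + ((q + 1 : ℕ) : ℤ) • (Q * P) with hG
  have hA : IsIntegralForm (q + 1) ((k + 2 : ℕ) : ℤ) (u • G + (-((q + 1 : ℕ) * y)) • R) 0 := by
    convert! (hQ.smul u).add (hR.smul (-((q + 1 : ℕ) * y))) using 1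
    push_cast at hy hpc ⊢
    rw [← hy]
    field_simp
    ring
  have hA0 : ((q + 1 : ℕ) : ℤ) ∣ constantCoeff (u • G + (-((q + 1 : ℕ) * y)) • R) :=
    ⟨u * constantCoeff Q * constantCoeff P - y * constantCoeff R, by simp [hG]; ring⟩
  obtain ⟨n, A, hn, hA⟩ := hA.exists_mem_integralCuspForms
    (by obtain ⟨m, hm⟩ := hk2; omega)
    (by simp [Nat.even_add, hk2]) hA0
  refine ⟨n * u * 12, (n * u) • (Q * P) - (n * y) • R + A,
    not_dvd_mul (not_dvd_mul hn hu) (not_dvd_twelve hp), ?_⟩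
  convert! hA using 1
  rw [hG]
  module

end Congruence

/-! ### Reduction modulo `p` -/

section Reduction

variable {p : ℕ} [Fact p.Prime] {k : ℤ} {P Q : PowerSeries ℤ} {f : PowerSeries (Fpbar p)}

lemma theta_map (P : PowerSeries ℤ) :
    theta p (PowerSeries.map (Int.castRingHom (Fpbar p)) P) =
      PowerSeries.map (Int.castRingHom (Fpbar p)) (X * PowerSeries.derivative ℤ P) := by
  rw [theta, map_mul, map_X]
  congr 1
  ext m
  simp [PowerSeries.coeff_derivative]

lemma map_mem_span_of_smul_add_mem {L : Set (PowerSeries ℤ)} {n : ℤ} (hn : ¬ (p : ℤ) ∣ n)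
    (h : n • P + (p : ℤ) • Q ∈ L) :
    PowerSeries.map (Int.castRingHom (Fpbar p)) P ∈
      Submodule.span (Fpbar p) (PowerSeries.map (Int.castRingHom (Fpbar p)) '' L) := by
  have hn' : (n : Fpbar p) ≠ 0 := by rwa [Ne, CharP.intCast_eq_zero_iff (Fpbar p) p]
  have h1 := Submodule.subset_span (R := Fpbar p)
    (Set.mem_image_of_mem (PowerSeries.map (Int.castRingHom (Fpbar p))) h)
  rw [map_add, map_zsmul, map_zsmul, ← Int.cast_smul_eq_zsmul (Fpbar p),
    ← Int.cast_smul_eq_zsmul (Fpbar p)] at h1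
  simp only [Int.cast_natCast, CharP.cast_eq_zero, zero_smul, add_zero] at h1
  exact (Submodule.smul_mem_iff _ hn').mp h1

/-- Since `θ` is linear, an inclusion `θ L ⊆ V` may be checked on integral generators. -/
lemma theta_mem_of_forall_mem {L : Set (PowerSeries ℤ)}
    {V : Submodule (Fpbar p) (PowerSeries (Fpbar p))}
    (hL : ∀ P ∈ L, theta p (PowerSeries.map (Int.castRingHom (Fpbar p)) P) ∈ V)
    (hf : f ∈ Submodule.span (Fpbar p) (PowerSeries.map (Int.castRingHom (Fpbar p)) '' L)) :
    theta p f ∈ V := by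
  induction hf using Submodule.span_induction with
  | mem f hf =>
    obtain ⟨P, hP, rfl⟩ := hf
    exact hL P hP
  | zero => simp [theta]
  | add f g _ _ hf hg =>
    rw [theta, map_add, mul_add]
    exact V.add_mem hf hg
  | smul c f _ hf =>
    rw [theta, Derivation.map_smul, mul_smul_comm]
    exact V.smul_mem c hf

lemma theta_mem_M (hp : 3 < p) (hf : f ∈ M p k) : theta p f ∈ M p (k + 2) := by
  refine theta_mem_of_forall_mem (fun P hP ↦ ?_) hf
  obtain ⟨b, hb⟩ := exists_isIntegralForm hP
  obtain ⟨Q, hQ⟩ := hb.theta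
  rw [theta_map]
  exact map_mem_span_of_smul_add_mem (not_dvd_twelve hp) hQ.mem_integralForms

lemma theta_mem_S_of_mem_S (hp : 3 < p) (hf : f ∈ S p k) : theta p f ∈ S p (k + 2) := by
  refine theta_mem_of_forall_mem (fun P hP ↦ ?_) hf
  obtain ⟨hb, hP0⟩ := isIntegralForm_of_mem_integralCuspForms hP
  obtain ⟨Q, hQ⟩ := hb.theta
  rw [mul_zero, zero_div] at hQ
  rw [theta_map]
  exact map_mem_span_of_smul_add_mem (not_dvd_twelve hp)
    (hQ.mem_integralCuspForms (by simp [hP0]))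

lemma theta_mem_S_of_mem_M (hp : 3 < p) (hk0 : 0 < k)
    (hk : ¬ ((p : ℤ) - 1 ∣ k) ∨ (p : ℤ) ∣ k) (hf : f ∈ M p k) : theta p f ∈ S p (k + 2) := by
  refine theta_mem_of_forall_mem (fun P hP ↦ ?_) hf
  rcases Int.even_or_odd k with hk2 | hk2
  · lift k to ℕ using hk0.le
    have hk' : ¬ (p - 1) ∣ k ∨ p ∣ k := by
      refine hk.imp (fun h h' ↦ h ?_) fun h ↦ by exact_mod_cast h
      rw [← Nat.cast_pred (by omega)]
      exact_mod_cast h'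
    obtain ⟨n, Q, hn, hQ⟩ := exists_theta_mem_integralCuspForms hp (by exact_mod_cast hk0)
      (by exact_mod_cast hk2) hk' hP
    rw [theta_map]
    exact map_mem_span_of_smul_add_mem hn hQ
  · rw [eq_zero_of_mem_integralForms_of_odd hk2 hP, map_zero, theta, map_zero, mul_zero]
    exact Submodule.zero_mem _

end Reduction

end ModPForms

end

theorem mainTheorem4 (p : ℕ) [Fact p.Prime] (hp : 3 < p) (k : ℤ) (hk : 0 < k)
    (f : PowerSeries (ModPForms.Fpbar p)) (hf : ModPForms.IsHeckeEigenform p k f) :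
    -- `θ f` is a form of weight `k + 2` with vanishing constant term
    ModPForms.theta p f ∈ ModPForms.M p (k + 2) ∧
    PowerSeries.constantCoeff (ModPForms.theta p f) = 0 ∧
    -- it is a simultaneous eigenvector, with eigenvalues `n * c n`
    (∀ (n : ℕ) (c : ModPForms.Fpbar p), 0 < n → ModPForms.heckeT p k n f = c • f →
      ModPForms.heckeT p (k + 2) n (ModPForms.theta p f) =
        ((n : ModPForms.Fpbar p) * c) • ModPForms.theta p f) ∧
    -- it is an eigenform (in particular nonzero) unless `f` is constant
    ((∀ a : ModPForms.Fpbar p, f ≠ PowerSeries.C a) →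
      ModPForms.IsHeckeEigenform p (k + 2) (ModPForms.theta p f)) ∧
    -- it is the reduction of a form that vanishes at both cusps
    ((f ∈ ModPForms.S p k ∨ ¬ ((p : ℤ) - 1 ∣ k) ∨ (p : ℤ) ∣ k) →
      ModPForms.theta p f ∈ ModPForms.S p (k + 2)) := by
  refine ⟨ModPForms.theta_mem_M hp hf.mem, ModPForms.constantCoeff_theta f,
    fun n c _ h ↦ ModPForms.heckeT_theta_of_eigen h, fun hC ↦
      ⟨ModPForms.theta_mem_M hp hf.mem, fun hθ ↦ ?_, fun n hn ↦ ?_⟩, ?_⟩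
  · obtain ⟨c, hc⟩ := hf.eigen p (Fact.out : p.Prime).pos
    exact hC _ (ModPForms.eq_C_of_theta_eq_zero hc hθ)
  · obtain ⟨c, hc⟩ := hf.eigen n hn
    exact ⟨_, ModPForms.heckeT_theta_of_eigen hc⟩
  · rintro (h | h)
    · exact ModPForms.theta_mem_S_of_mem_S hp h
    · exact ModPForms.theta_mem_S_of_mem_M hp hk h hf.mem
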